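/- Let $\mathbb{N}=\{1,2,3,\dots\}$ and, for $\sigma\in\mathbb{R}$, let $\mathbb{C}_\sigma=\{s\in\mathbb{C}:\operatorname{Re}s>\sigma\}$. For a set $S\subset\mathbb{N}$, let $\mathscr{H}^2_S$ be the Hilbert space of all functions $g(s)=\sum_{n=1}^\infty b_n n^{-s}$ on $\mathbb{C}_{1/2}$ whose complex coefficients satisfy $\|g\|_2:=\big(\sum_{n=1}^\infty|b_n|^2\big)^{1/2}<\infty$ and $b_n=0$ for all $n\in\mathbb{N}\setminus S$. Let $\mathscr{H}^\infty_S$ be the set of all Dirichlet series $F(s)=\sum_{n=1}^\infty a_n n^{-s}$ with complex coefficients that converge (not necessarily absolutely) at every $s\in\mathbb{C}_0$, satisfy $\|F\|_\infty:=\sup_{s\in\mathbb{C}_0}|F(s)|<\infty$, and have $a_n=0$ for all $n\in\mathbb{N}\setminus S$. Let $S$ be a multiplicative subsemigroup of $\mathbb{N}$ with $1\in S$. Then $\mathscr{H}^\infty_S$ is exactly the multiplier algebra of $\mathscr{H}^2_S$; that is, a function $f:\mathbb{C}_{1/2}\to\mathbb{C}$ satisfies $fg\in\mathscr{H}^2_S$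 for all $g\in\mathscr{H}^2_S$ if and only if $f$ has an extension $F$ to $\mathbb{C}_0$ which is an element of $\mathscr{H}^\infty_S$. Moreover, in that case, $$\|F\|_\infty=\sup_{g\in\mathscr{H}^2_S,\ \|g\|_2\le 1}\|fg\|_2 ,$$ that is, $\|F\|_\infty$ equals the operator norm of multiplication by $f$ on $\mathscr{H}^2_S$. -/

import Mathlib

namespace DirichletHardy

open Filter Topology

/-- The open half-plane `{s : ℂ | σ < Re s}`. -/
def halfPlane (σ : ℝ) : Set ℂ := {s | σ < s.re}

/-- `f` is, on the half-plane `Re s > σ`, the sum of the Dirichlet series with coefficients `a n`,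
`n = 1, 2, 3, …`: at each point of the half-plane the partial sums converge (possibly only
conditionally) to the value of `f`. An `ArithmeticFunction ℂ` is a sequence `ℕ → ℂ` that vanishes
at `0`, hence the same thing as a sequence of complex numbers indexed by the positive integers. -/
def HasDirichletSeries {σ : ℝ} (f : halfPlane σ → ℂ) (a : ArithmeticFunction ℂ) : Prop :=
  ∀ s : halfPlane σ,
    Tendsto (fun N : ℕ => ∑ n ∈ Finset.Icc 1 N, a n * (n : ℂ) ^ (-(s : ℂ))) atTop (𝓝 (f s))

/-- All coefficients outside `S` vanish. -/
def SupportedOn (S : Set ℕ+) (a : ArithmeticFunction ℂ) : Prop :=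
  ∀ n : ℕ+, n ∉ S → a n = 0

/-- `𝓗²_S`, as a space of functions on `Re s > 1/2`: the sums of the Dirichlet series with
square-summable coefficients that vanish outside `S`. -/
def H2 (S : Set ℕ+) : Set (halfPlane (1 / 2) → ℂ) :=
  {f | ∃ a : ArithmeticFunction ℂ,
    SupportedOn S a ∧ Summable (fun n : ℕ => ‖a n‖ ^ 2) ∧ HasDirichletSeries f a}

/-- `𝓗^∞_S`, as a space of functions on `Re s > 0`: the bounded sums of the Dirichlet series that
converge at each point of this half-plane and whose coefficients vanish outside `S`. -/
def HInfty (S : Set ℕ+) : Set (halfPlane 0 → ℂ) :=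
  {F | ∃ a : ArithmeticFunction ℂ,
    SupportedOn S a ∧ HasDirichletSeries F a ∧ BddAbove (Set.range fun s => ‖F s‖)}

/-- `F`, defined on `Re s > 0`, extends `f`, defined on `Re s > 1/2`. -/
def Extends (F : halfPlane 0 → ℂ) (f : halfPlane (1 / 2) → ℂ) : Prop :=
  ∀ (s : ℂ) (h₀ : s ∈ halfPlane 0) (h : s ∈ halfPlane (1 / 2)), F ⟨s, h₀⟩ = f ⟨s, h⟩

/-- The supremum norm `‖F‖_∞` over `Re s > 0`. -/
noncomputable def supNorm (F : halfPlane 0 → ℂ) : ℝ := ⨆ s, ‖F s‖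

open Classical in
/-- The coefficients of the Dirichlet series of `f` (zero if `f` is not the sum of one); they are
unique, see `coeff_eq`. -/
noncomputable def coeff {σ : ℝ} (f : halfPlane σ → ℂ) : ArithmeticFunction ℂ :=
  if h : ∃ a, HasDirichletSeries f a then h.choose else 0

/-- The norm `‖f‖₂` of `f = ∑ aₙ n⁻ˢ` in `𝓗²`, that is `(∑ |aₙ|²)^(1/2)`; see `norm2_eq`. -/
noncomputable def norm2 (f : halfPlane (1 / 2) → ℂ) : ℝ := √(∑' n : ℕ, ‖coeff f n‖ ^ 2)

theorem abscissa_lt_top {σ : ℝ} {f : halfPlane σ → ℂ} {a : ArithmeticFunction ℂ}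
    (h : HasDirichletSeries f a) : LSeries.abscissaOfAbsConv (fun n => a n) < ⊤ := by
  have hs : ((σ + 1 : ℝ) : ℂ) ∈ halfPlane σ := by simp [halfPlane]
  have h1 := h ⟨_, hs⟩
  have h2 := (h1.comp (tendsto_add_atTop_nat 1)).sub h1
  have h3 : Tendsto (fun N : ℕ => a (N + 1) * ((N + 1 : ℕ) : ℂ) ^ (-((σ + 1 : ℝ) : ℂ))) atTop
      (𝓝 0) := by
    rw [sub_self] at h2
    refine h2.congr fun N => ?_
    simp [Finset.sum_Icc_succ_top]
  obtain ⟨C, hC⟩ := h3.norm.bddAbove_range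
  refine (LSeries.abscissaOfAbsConv_le_of_le_const_mul_rpow (x := σ + 1)
    ⟨C, fun n hn => ?_⟩).trans_lt (by exact_mod_cast EReal.coe_lt_top (σ + 1 + 1))
  obtain ⟨m, rfl⟩ := Nat.exists_eq_succ_of_ne_zero hn
  have h4 := hC ⟨m, rfl⟩
  simp only [norm_mul] at h4
  rw [Complex.norm_natCast_cpow_of_pos (Nat.succ_pos m), Complex.neg_re, Complex.ofReal_re,
    Real.rpow_neg (Nat.cast_nonneg _), ← div_eq_mul_inv,
    div_le_iff₀ (Real.rpow_pos_of_pos (by exact_mod_cast Nat.succ_pos m) _)] at h4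
  exact h4

theorem eq_LSeries {σ : ℝ} {f : halfPlane σ → ℂ} {a : ArithmeticFunction ℂ}
    (h : HasDirichletSeries f a) (s : halfPlane σ) (hs : LSeriesSummable (fun n => a n) s) :
    LSeries (fun n => a n) s = f s := by
  have h1 := (hs.hasSum.tendsto_sum_nat).comp (tendsto_add_atTop_nat 1)
  refine tendsto_nhds_unique h1 ((h s).congr fun N => ?_)
  rw [Function.comp_apply, Finset.sum_range_succ', LSeries.term_zero, add_zero]
  induction N with
  | zero => simp
  | succ N ih =>
    rw [Finset.sum_Icc_succ_top (by omega), Finset.sum_range_succ, ih,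
      LSeries.term_of_ne_zero (by omega), Complex.cpow_neg, div_eq_mul_inv]

/-- A function on a half-plane is the sum of at most one Dirichlet series. -/
theorem HasDirichletSeries.unique {σ : ℝ} {f : halfPlane σ → ℂ} {a b : ArithmeticFunction ℂ}
    (ha : HasDirichletSeries f a) (hb : HasDirichletSeries f b) : a = b := by
  have hA := abscissa_lt_top ha
  have hB := abscissa_lt_top hb
  have key : (fun x : ℝ => LSeries (fun n => a n) x) =ᶠ[atTop]
      fun x => LSeries (fun n => b n) x := by
    obtain ⟨y, hy, -⟩ := EReal.exists_between_coe_real (max_lt hA hB)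
    filter_upwards [eventually_ge_atTop y, eventually_gt_atTop σ] with x hx hσ
    have hyx : (y : EReal) ≤ ((x : ℂ).re : EReal) := by simpa using hx
    have hm : (x : ℂ) ∈ halfPlane σ := by simpa [halfPlane] using hσ
    rw [eq_LSeries ha ⟨x, hm⟩ (LSeriesSummable_of_abscissaOfAbsConv_lt_re
        (((le_max_left _ _).trans_lt hy).trans_le hyx)),
      eq_LSeries hb ⟨x, hm⟩ (LSeriesSummable_of_abscissaOfAbsConv_lt_re
        (((le_max_right _ _).trans_lt hy).trans_le hyx))]
  ext n
  rcases eq_or_ne n 0 with rfl | hn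
  · simp
  · exact LSeries.eq_of_LSeries_eventually_eq hA hB key hn

theorem coeff_eq {σ : ℝ} {f : halfPlane σ → ℂ} {a : ArithmeticFunction ℂ}
    (h : HasDirichletSeries f a) : coeff f = a := by
  have hex : ∃ a, HasDirichletSeries f a := ⟨a, h⟩
  rw [coeff, dif_pos hex]
  exact hex.choose_spec.unique h

theorem norm2_eq {f : halfPlane (1 / 2) → ℂ} {a : ArithmeticFunction ℂ}
    (h : HasDirichletSeries f a) : norm2 f = √(∑' n : ℕ, ‖a n‖ ^ 2) := by
  rw [norm2, coeff_eq h]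

end DirichletHardy

namespace DirichletHardy

open Filter Topology

/-! Both implications are proved with the same constant `M`: if Dirichlet convolution with `a` has
norm at most `M` on the square-summable sequences supported on `S`, then `∑ aₙ n⁻ˢ` converges on `Re
s > 0` and is bounded by `M` there, and conversely. Equality of the norms follows at once.

From multiplier to bounded series. Since `1 ∈ S`, `f = f · 1` lies in `𝓗²_S` and has coefficients
`a`; the closed graph theorem (`exists_convolutionBound`) gives `M`. Iterating on the unit yields
`‖aᵏ‖₂ ≤ Mᵏ`. Restriction to `d`-smooth numbers respects convolution, and `∑ n^(-2σ)` over smooth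
`n` is finite for every `σ > 0`, so Cauchy–Schwarz gives `|A_d(s)|ᵏ ≤ Mᵏ W` with `W` independent of
`k`; thus `|A_d| ≤ M` on `Re s > 0` (`norm_LSeries_smoothPart_le`). To let `d → ∞`, partial sums
must be controlled uniformly in `d`: kernels of `L¹` norm `O(N^θ)` whose Fourier transform cuts off
at `log N` bound them by `O(M N^θ)` for every small `θ > 0` (`exists_norm_partialSum_le`). For `d >
N` these are the partial sums of the full series, and Abel summation gives convergence and the bound
(`exists_tendsto_partialSum`).

From bounded series to multiplier. Averaging `F` along vertical lines against a Gaussian multiplies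
`aₙ` by `exp(-v log² n / 2)`. The damped series converges absolutely everywhere and is still bounded
by `M`, even on the imaginary axis (`norm_LSeries_gaussianDamp_le`). There Parseval for Gaussian
means bounds its convolution with a finite sequence (`tsum_sq_mul_le`); letting `v → 0` on finitely
many coefficients removes the damping (`sum_sq_mul_le`). -/

/-! ### Abel summation for Dirichlet series. -/

/-- The `N`-th partial sum of a Dirichlet series. -/
noncomputable def partialSum (a : ℕ → ℂ) (s : ℂ) (N : ℕ) : ℂ :=
  ∑ n ∈ Finset.Icc 1 N, a n * (n : ℂ) ^ (-s)

@[simp] theorem partialSum_zero (a : ℕ → ℂ) (s : ℂ) : partialSum a s 0 = 0 := by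
  simp [partialSum]

theorem partialSum_succ (a : ℕ → ℂ) (s : ℂ) (N : ℕ) :
    partialSum a s (N + 1) = partialSum a s N + a (N + 1) * ((N + 1 : ℕ) : ℂ) ^ (-s) := by
  simp [partialSum, Finset.sum_Icc_succ_top]

/-- The weight `n⁻ʷ - (n + 1)⁻ʷ` of summation by parts. -/
noncomputable def abelWeight (w : ℂ) (n : ℕ) : ℂ := (n : ℂ) ^ (-w) - ((n + 1 : ℕ) : ℂ) ^ (-w)

/-- Summation by parts. The index `n = 0` is harmless, whatever `abelWeight w 0` is, because the
empty partial sum vanishes. -/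
theorem partialSum_add (a : ℕ → ℂ) (s w : ℂ) (N : ℕ) :
    partialSum a (s + w) N = partialSum a s N * ((N + 1 : ℕ) : ℂ) ^ (-w) +
      ∑ n ∈ Finset.range (N + 1), partialSum a s n * abelWeight w n := by
  induction N with
  | zero => simp
  | succ N ih =>
    rw [partialSum_succ, ih, Finset.sum_range_succ _ (N + 1), abelWeight, partialSum_succ a s,
      neg_add, Complex.cpow_add _ _ (Nat.cast_ne_zero.2 N.succ_ne_zero)]
    ring

/-- Mean value inequality on `[n, n + 1]`: the derivative `-w x^(-w-1)` is largest in norm at the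
left end. -/
theorem norm_abelWeight_le {w : ℂ} (hw : 0 < w.re) {n : ℕ} (hn : n ≠ 0) :
    ‖abelWeight w n‖ ≤ ‖w‖ * (n : ℝ) ^ (-w.re - 1) := by
  have hn' : (0 : ℝ) < n := by positivity
  have key := (convex_Icc (n : ℝ) (n + 1)).norm_image_sub_le_of_norm_hasDerivWithin_le
    (f := fun x : ℝ => (x : ℂ) ^ (-w)) (f' := fun x : ℝ => -w * (x : ℂ) ^ (-w - 1))
    (C := ‖w‖ * (n : ℝ) ^ (-w.re - 1)) (x := n + 1) (y := n) ?_ ?_ (by simp) (by simp)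
  · simpa [abelWeight] using key
  · intro x hx
    have hx0 : 0 < x := hn'.trans_le hx.1
    refine HasDerivAt.hasDerivWithinAt ?_
    have h0 : -w ≠ 0 := by rintro h; simp [neg_eq_zero.1 h] at hw
    exact hasDerivAt_ofReal_cpow_const hx0.ne' h0
  · intro x hx
    have hx0 : 0 < x := hn'.trans_le hx.1
    rw [norm_mul, norm_neg, Complex.norm_cpow_eq_rpow_re_of_pos hx0]
    refine mul_le_mul_of_nonneg_left ?_ (norm_nonneg _)
    simp only [Complex.sub_re, Complex.neg_re, Complex.one_re]
    exact Real.rpow_le_rpow_of_nonpos hn' hx.1 (by linarith)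

theorem norm_mul_abelWeight_le {a : ℕ → ℂ} {s w : ℂ} {C θ : ℝ} (hw : 0 < w.re)
    (h : ∀ n, ‖partialSum a s n‖ ≤ C * (n : ℝ) ^ θ) (n : ℕ) :
    ‖partialSum a s n * abelWeight w n‖ ≤ C * ‖w‖ * (n : ℝ) ^ (θ - w.re - 1) := by
  rcases eq_or_ne n 0 with rfl | hn
  · have := (norm_nonneg _).trans (h 1)
    simp only [Nat.cast_one, Real.one_rpow, mul_one] at this
    simp only [partialSum_zero, zero_mul, norm_zero]
    positivity
  have hn' : (0 : ℝ) < n := by positivity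
  calc _ ≤ C * (n : ℝ) ^ θ * (‖w‖ * (n : ℝ) ^ (-w.re - 1)) := by
        rw [norm_mul]
        exact mul_le_mul (h n) (norm_abelWeight_le hw hn) (norm_nonneg _)
          ((norm_nonneg _).trans (h n))
    _ = _ := by
        rw [show θ - w.re - 1 = θ + (-w.re - 1) by ring, Real.rpow_add hn']
        ring

theorem summable_rpow_sub_one {x : ℝ} (hx : x < 0) : Summable fun n : ℕ => (n : ℝ) ^ (x - 1) :=
  Real.summable_nat_rpow.2 (by linarith)

/-- Convergence of a Dirichlet series to the right of a point at which its partial sums grow at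
most like `n ^ θ`. -/
theorem tendsto_partialSum_add {a : ℕ → ℂ} {s w : ℂ} {C θ : ℝ} (hθ : 0 ≤ θ) (hw : θ < w.re)
    (h : ∀ n, ‖partialSum a s n‖ ≤ C * (n : ℝ) ^ θ) :
    Tendsto (partialSum a (s + w)) atTop (𝓝 (∑' n, partialSum a s n * abelWeight w n)) := by
  have hsum : Summable fun n => partialSum a s n * abelWeight w n :=
    .of_norm_bounded ((summable_rpow_sub_one (x := θ - w.re) (by linarith)).mul_left (C * ‖w‖))
      (norm_mul_abelWeight_le (hθ.trans_lt hw) h)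
  have h1 := hsum.hasSum.tendsto_sum_nat.comp (tendsto_add_atTop_nat 1)
  have h2 : Tendsto (fun N : ℕ => partialSum a s N * ((N + 1 : ℕ) : ℂ) ^ (-w)) atTop (𝓝 0) := by
    have hC : 0 ≤ C := by simpa using (norm_nonneg _).trans (h 1)
    have h3 : Tendsto (fun N : ℕ => C * ((N + 1 : ℕ) : ℝ) ^ (-(w.re - θ))) atTop (𝓝 0) := by
      simpa using (((tendsto_rpow_neg_atTop (by linarith : 0 < w.re - θ)).comp
        tendsto_natCast_atTop_atTop).comp (tendsto_add_atTop_nat 1)).const_mul C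
    refine squeeze_zero_norm (fun N => ?_) h3
    have hN : (0 : ℝ) < ((N + 1 : ℕ) : ℝ) := by positivity
    rw [norm_mul, Complex.norm_natCast_cpow_of_pos N.succ_pos, Complex.neg_re,
      show -(w.re - θ) = θ + -w.re by ring, Real.rpow_add hN, ← mul_assoc]
    refine mul_le_mul_of_nonneg_right ((h N).trans ?_) (by positivity)
    gcongr
    simp
  simpa only [zero_add] using (h2.add h1).congr fun N => (partialSum_add a s w N).symm

theorem differentiable_abelWeight (n : ℕ) (hn : n ≠ 0) :
    Differentiable ℂ fun w => abelWeight w n := by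
  have h1 : (n : ℂ) ≠ 0 := Nat.cast_ne_zero.2 hn
  have h2 : ((n + 1 : ℕ) : ℂ) ≠ 0 := Nat.cast_ne_zero.2 n.succ_ne_zero
  exact fun w => ((differentiableAt_id.neg).const_cpow (.inl h1)).sub
    ((differentiableAt_id.neg).const_cpow (.inl h2))

/-- A Dirichlet series with bounded partial sums at `s` is analytic to the right of `s`. -/
theorem differentiableOn_tsum_abelWeight {a : ℕ → ℂ} {s : ℂ} {C : ℝ}
    (h : ∀ n, ‖partialSum a s n‖ ≤ C) :
    DifferentiableOn ℂ (fun w => ∑' n, partialSum a s n * abelWeight w n) {w | 0 < w.re} := by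
  intro w hw
  have hw : 0 < w.re := hw
  have hC : 0 ≤ C := (norm_nonneg _).trans (h 0)
  -- A summable majorant uniform in `z` needs `Re z` bounded below, for the exponent, and `‖z‖`
  -- bounded above, for the factor in `norm_abelWeight_le`.
  set U : Set ℂ := {z | w.re / 2 < z.re} ∩ Metric.ball 0 (‖w‖ + 1)
  have hU : IsOpen U :=
    (isOpen_lt continuous_const Complex.continuous_re).inter Metric.isOpen_ball
  have hwU : w ∈ U := ⟨by simpa using hw, by simp⟩
  refine DifferentiableAt.differentiableWithinAt
    (DifferentiableOn.differentiableAt ?_ (hU.mem_nhds hwU))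
  refine Complex.differentiableOn_tsum_of_summable_norm
    ((summable_rpow_sub_one (x := -(w.re / 2)) (by linarith)).mul_left (C * (‖w‖ + 1)))
    (fun n => ?_) hU fun n z hz => ?_
  · rcases eq_or_ne n 0 with rfl | hn
    · simp
    · exact ((differentiable_abelWeight n hn).const_mul _).differentiableOn
  · obtain ⟨hz1, hz2⟩ := hz
    have hz1 : w.re / 2 < z.re := hz1
    have hz2 : ‖z‖ < ‖w‖ + 1 := by simpa using hz2
    rcases eq_or_ne n 0 with rfl | hn
    · simp only [partialSum_zero, zero_mul, norm_zero]
      positivity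
    refine (norm_mul_abelWeight_le (θ := 0) (by linarith) (by simpa using h) n).trans ?_
    refine mul_le_mul (by gcongr) ?_ (by positivity) (by positivity)
    exact Real.rpow_le_rpow_of_exponent_le (by exact_mod_cast Nat.one_le_iff_ne_zero.2 hn)
      (by linarith)

/-! ### Fourier transforms of trapezoids and cutoff kernels. -/

open MeasureTheory FourierTransform Convolution in
theorem norm_fourier_indicator_le {u : ℝ} (hu : 0 ≤ u) (ξ : ℝ) :
    ‖𝓕 ((Set.Icc (-u) u).indicator fun _ => (1 : ℂ)) ξ‖ ≤ 2 * u := by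
  rw [Real.fourier_eq]
  refine (norm_integral_le_integral_norm _).trans ?_
  have : ∀ v : ℝ, ‖Real.fourierChar (-inner ℝ v ξ) • (Set.Icc (-u) u).indicator (fun _ => (1 : ℂ)) v‖
      = (Set.Icc (-u) u).indicator (fun _ => (1 : ℝ)) v := by
    intro v
    by_cases hv : v ∈ Set.Icc (-u) u <;> simp [hv]
  simp_rw [this]
  rw [integral_indicator measurableSet_Icc]
  simp only [integral_const, smul_eq_mul, mul_one, measureReal_restrict_apply_univ,
    Real.volume_real_Icc]
  rw [max_eq_left (by linarith)]
  linarith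

open MeasureTheory FourierTransform Convolution in
theorem norm_fourier_indicator_le_inv {u : ℝ} (hu : 0 ≤ u) {ξ : ℝ} (hξ : ξ ≠ 0) :
    ‖𝓕 ((Set.Icc (-u) u).indicator fun _ => (1 : ℂ)) ξ‖ ≤ |ξ|⁻¹ := by
  have h0 : (-2 * Real.pi * ξ * Complex.I : ℂ) ≠ 0 := by
    simp [Real.pi_ne_zero, hξ]
  have h1 : 𝓕 ((Set.Icc (-u) u).indicator fun _ => (1 : ℂ)) ξ =
      ∫ v in (-u)..u, Complex.exp ((-2 * Real.pi * ξ * Complex.I) * v) := by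
    rw [Real.fourier_real_eq_integral_exp_smul, intervalIntegral.integral_of_le (by linarith),
      ← integral_Icc_eq_integral_Ioc, ← integral_indicator measurableSet_Icc]
    refine integral_congr_ae (Eventually.of_forall fun v => ?_)
    by_cases hv : v ∈ Set.Icc (-u) u
    · simp only [hv, Set.indicator_of_mem, smul_eq_mul, mul_one]
      congr 1
      push_cast
      ring
    · simp [hv]
  have h2 : ∀ x : ℝ, ‖Complex.exp ((-2 * Real.pi * ξ * Complex.I) * x)‖ = 1 := by
    intro x
    rw [show (-2 * Real.pi * ξ * Complex.I) * x = ((-2 * Real.pi * ξ * x : ℝ) : ℂ) * Complex.I by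
      push_cast; ring]
    exact Complex.norm_exp_ofReal_mul_I _
  rw [h1, integral_exp_mul_complex h0, norm_div]
  have h3 : ‖(-2 * Real.pi * ξ * Complex.I : ℂ)‖ = 2 * Real.pi * |ξ| := by
    simp [abs_of_pos Real.pi_pos]
  rw [h3, div_le_iff₀ (by positivity)]
  refine (norm_sub_le _ _).trans ?_
  rw [h2, h2]
  have : |ξ|⁻¹ * (2 * Real.pi * |ξ|) = 2 * Real.pi := by field_simp
  rw [this]
  linarith [Real.two_le_pi]

open MeasureTheory FourierTransform Convolution in
theorem integrable_indicator_Icc_one (u : ℝ) :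
    Integrable ((Set.Icc (-u) u).indicator fun _ => (1 : ℂ)) :=
  (integrable_indicator_iff measurableSet_Icc).2 (by simp)

open MeasureTheory Convolution in
theorem convolution_indicator_eq (c : ℝ) {h : ℝ} (hh : 0 ≤ h) (x : ℝ) :
    ((Set.Icc (-h) h).indicator (fun _ => (1 : ℂ)) ⋆[ContinuousLinearMap.mul ℂ ℂ]
      (Set.Icc (-c) c).indicator fun _ => (1 : ℂ)) x =
      ∫ t in (x - h)..(x + h), (Set.Icc (-c) c).indicator (fun _ => (1 : ℂ)) t := by
  have h1 := intervalIntegral.integral_comp_sub_left (a := -h) (b := h)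
    ((Set.Icc (-c) c).indicator fun _ => (1 : ℂ)) x
  rw [sub_neg_eq_add] at h1
  rw [← h1, convolution_def, intervalIntegral.integral_of_le (by linarith),
      ← integral_Icc_eq_integral_Ioc, ← integral_indicator measurableSet_Icc]
  refine integral_congr_ae (Eventually.of_forall fun v => ?_)
  by_cases hv : v ∈ Set.Icc (-h) h <;> simp [hv]

-- The convolution is a difference of two translates of a primitive. Continuity is what permits
-- pointwise Fourier inversion later.
open MeasureTheory Convolution in
theorem continuous_convolution_indicator (c : ℝ) {h : ℝ} (hh : 0 ≤ h) :
    Continuous ((Set.Icc (-h) h).indicator (fun _ => (1 : ℂ)) ⋆[ContinuousLinearMap.mul ℂ ℂ]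
      (Set.Icc (-c) c).indicator fun _ => (1 : ℂ)) := by
  have hi := integrable_indicator_Icc_one c
  have h1 := intervalIntegral.continuous_primitive
    (fun a b => hi.intervalIntegrable (a := a) (b := b)) 0
  have h2 : Continuous fun x : ℝ =>
      (∫ t in (0 : ℝ)..(x + h), (Set.Icc (-c) c).indicator (fun _ => (1 : ℂ)) t) -
      ∫ t in (0 : ℝ)..(x - h), (Set.Icc (-c) c).indicator (fun _ => (1 : ℂ)) t :=
    (h1.comp (continuous_id.add continuous_const)).sub
      (h1.comp (continuous_id.sub continuous_const))
  refine h2.congr fun x => ?_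
  rw [convolution_indicator_eq c hh, intervalIntegral.integral_interval_sub_left
    hi.intervalIntegrable hi.intervalIntegrable]

open MeasureTheory Convolution in
theorem convolution_indicator_of_le {c h : ℝ} (hh : 0 ≤ h) {x : ℝ} (hx : |x| ≤ c - h) :
    ((Set.Icc (-h) h).indicator (fun _ => (1 : ℂ)) ⋆[ContinuousLinearMap.mul ℂ ℂ]
      (Set.Icc (-c) c).indicator fun _ => (1 : ℂ)) x = 2 * h := by
  rw [abs_le] at hx
  rw [convolution_indicator_eq c hh, intervalIntegral.integral_congr (g := fun _ => (1 : ℂ))]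
  · simp
    ring
  · intro t ht
    rw [Set.uIcc_of_le (by linarith)] at ht
    have ht' : t ∈ Set.Icc (-c) c := ⟨by linarith [ht.1], by linarith [ht.2]⟩
    simp [ht']

open MeasureTheory Convolution in
theorem convolution_indicator_of_ge {c h : ℝ} (hh : 0 ≤ h) {x : ℝ} (hx : c + h ≤ |x|) :
    ((Set.Icc (-h) h).indicator (fun _ => (1 : ℂ)) ⋆[ContinuousLinearMap.mul ℂ ℂ]
      (Set.Icc (-c) c).indicator fun _ => (1 : ℂ)) x = 0 := by
  rw [convolution_indicator_eq c hh, intervalIntegral.integral_of_le (by linarith),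
    integral_Ioc_eq_integral_Ioo]
  refine setIntegral_eq_zero_of_forall_eq_zero ?_
  rintro t ⟨ht1, ht2⟩
  have ht : t ∉ Set.Icc (-c) c := by
    rintro ⟨h1, h2⟩
    rcases le_abs.1 hx with h | h <;> linarith
  simp [ht]

open MeasureTheory FourierTransform Convolution in
/-- The Fourier transform of a trapezoid, with the plateau `[h - c, c - h]` and the support
`[-c - h, c + h]`: its decay. -/
theorem norm_fourier_convolution_indicator_le {c h θ : ℝ} (hc : 0 ≤ c) (hh : 0 < h) (hθ : 0 < θ)
    (hθ1 : θ ≤ 1) (ξ : ℝ) :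
    ‖𝓕 ((Set.Icc (-h) h).indicator (fun _ => (1 : ℂ)) ⋆[ContinuousLinearMap.mul ℂ ℂ]
      (Set.Icc (-c) c).indicator fun _ => (1 : ℂ)) ξ‖ ≤
      2 * h * (max (2 * c) ((2 * h) ^ (-θ)) * 2 ^ (1 + θ)) * (1 + ‖ξ‖) ^ (-(1 + θ)) := by
  rw [Real.fourier_mul_convolution_eq (integrable_indicator_Icc_one h)
    (integrable_indicator_Icc_one c), norm_mul]
  have hA := norm_fourier_indicator_le hh.le ξ
  have hB := norm_fourier_indicator_le hc ξ
  have hp : 0 < 1 + ‖ξ‖ := by positivity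
  rcases le_or_gt ‖ξ‖ 1 with h1 | h1
  · have h2 : 1 ≤ 2 ^ (1 + θ) * (1 + ‖ξ‖) ^ (-(1 + θ)) := by
      rw [Real.rpow_neg hp.le, ← div_eq_mul_inv, one_le_div (by positivity)]
      exact Real.rpow_le_rpow hp.le (by linarith) (by linarith)
    calc _ ≤ 2 * h * max (2 * c) ((2 * h) ^ (-θ)) := by
          gcongr
          exact hB.trans (le_max_left _ _)
      _ ≤ 2 * h * max (2 * c) ((2 * h) ^ (-θ)) * (2 ^ (1 + θ) * (1 + ‖ξ‖) ^ (-(1 + θ))) :=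
          le_mul_of_one_le_right (by positivity) h2
      _ = _ := by ring
  · have hξ : ξ ≠ 0 := by rintro rfl; norm_num at h1
    have hξ' : 0 < |ξ| := abs_pos.2 hξ
    have hA' := norm_fourier_indicator_le_inv hh.le hξ
    have hB' := norm_fourier_indicator_le_inv hc hξ
    set α := ‖𝓕 ((Set.Icc (-h) h).indicator fun _ => (1 : ℂ)) ξ‖ with hα
    have hα0 : 0 ≤ α := norm_nonneg _
    -- Interpolation between the bounds `2h` and `|ξ|⁻¹`. The second alone would give decay `|ξ|⁻²`
    -- but lose the factor `2h` by which the kernel is later divided.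
    have h3 : α ≤ 2 * h * (2 * h) ^ (-θ) * |ξ| ^ (-θ) := by
      rcases hα0.eq_or_lt with h0 | h0
      · rw [← h0]; positivity
      calc α = α ^ (1 - θ) * α ^ θ := by rw [← Real.rpow_add h0]; simp
        _ ≤ (2 * h) ^ (1 - θ) * (|ξ|⁻¹) ^ θ := by
            gcongr
        _ = _ := by
            rw [sub_eq_add_neg, Real.rpow_add (by positivity), Real.rpow_one,
              Real.inv_rpow hξ'.le, Real.rpow_neg hξ'.le]
    have h4 : |ξ| ^ (-(1 + θ)) ≤ 2 ^ (1 + θ) * (1 + ‖ξ‖) ^ (-(1 + θ)) := by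
      rw [Real.rpow_neg hp.le, ← div_eq_mul_inv, le_div_iff₀ (by positivity),
        Real.rpow_neg hξ'.le, inv_mul_le_iff₀ (by positivity),
        ← Real.mul_rpow hξ'.le (by norm_num)]
      refine Real.rpow_le_rpow hp.le ?_ (by linarith)
      rw [Real.norm_eq_abs] at h1 ⊢
      linarith
    calc _ ≤ 2 * h * (2 * h) ^ (-θ) * |ξ| ^ (-θ) * |ξ|⁻¹ := by gcongr
      _ = 2 * h * (2 * h) ^ (-θ) * |ξ| ^ (-(1 + θ)) := by
          rw [neg_add, Real.rpow_add hξ', Real.rpow_neg_one]; ring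
      _ ≤ 2 * h * max (2 * c) ((2 * h) ^ (-θ)) * (2 ^ (1 + θ) * (1 + ‖ξ‖) ^ (-(1 + θ))) := by
          gcongr
          exact le_max_right _ _
      _ = _ := by ring

open MeasureTheory FourierTransform Convolution in
/-- Kernels that cut a Dirichlet series off at `N`, with `L¹` norms `O(N ^ θ)`. -/
theorem exists_cutoff_kernel {θ : ℝ} (hθ : 0 < θ) (hθ1 : θ ≤ 1) :
    ∃ C : ℝ, 0 ≤ C ∧ ∀ N : ℕ, N ≠ 0 → ∃ K : ℝ → ℂ, Integrable K ∧ ∫ ξ, ‖K ξ‖ ≤ C * (N : ℝ) ^ θ ∧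
      (∀ x : ℝ, |x| ≤ Real.log N →
        ∫ ξ : ℝ, Complex.exp (2 * Real.pi * ξ * x * Complex.I) * K ξ = 1) ∧
      ∀ x : ℝ, Real.log (N + 1) ≤ |x| →
        ∫ ξ : ℝ, Complex.exp (2 * Real.pi * ξ * x * Complex.I) * K ξ = 0 := by
  have hJ : Integrable fun ξ : ℝ => (1 + ‖ξ‖) ^ (-(1 + θ)) :=
    integrable_one_add_norm (by simpa using hθ)
  set J := ∫ ξ : ℝ, (1 + ‖ξ‖) ^ (-(1 + θ)) with hJdef
  have hJ0 : 0 ≤ J := integral_nonneg fun ξ => by positivity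
  refine ⟨(2 / θ + 1) * 2 ^ θ * 2 ^ (1 + θ) * J, by positivity, fun N hN => ?_⟩
  have hN0 : (0 : ℝ) < N := by positivity
  have hN1 : (1 : ℝ) ≤ N := by exact_mod_cast Nat.one_le_iff_ne_zero.2 hN
  have hlog : Real.log N < Real.log (N + 1) := Real.log_lt_log hN0 (by linarith)
  have hlog0 : 0 ≤ Real.log N := Real.log_nonneg hN1
  -- Chosen so that the plateau ends at `c - h = log N` and the support at `c + h = log (N + 1)`; no
  -- integer has its logarithm strictly between.
  set h := (Real.log (N + 1) - Real.log N) / 2 with hh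
  set c := (Real.log (N + 1) + Real.log N) / 2 with hc
  have hh0 : 0 < h := by linarith
  have hc0 : 0 ≤ c := by linarith
  set φ := (Set.Icc (-h) h).indicator (fun _ => (1 : ℂ)) ⋆[ContinuousLinearMap.mul ℂ ℂ]
      (Set.Icc (-c) c).indicator fun _ => (1 : ℂ) with hφ
  have hφi : Integrable φ := (integrable_indicator_Icc_one h).integrable_convolution _
    (integrable_indicator_Icc_one c)
  have hφc : Continuous φ := continuous_convolution_indicator c hh0.le
  have hb := norm_fourier_convolution_indicator_le hc0 hh0 hθ hθ1
  rw [← hφ] at hb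
  have hKi : Integrable (𝓕 φ) :=
    (hJ.const_mul _).mono' (VectorFourier.fourierIntegral_continuous Real.continuous_fourierChar continuous_inner hφi).aestronglyMeasurable
      (Eventually.of_forall hb)
  have hinv : ∀ x : ℝ, ∫ ξ : ℝ, Complex.exp (2 * Real.pi * ξ * x * Complex.I) *
      ((2 * h : ℂ)⁻¹ * 𝓕 φ ξ) = (2 * h : ℂ)⁻¹ * φ x := by
    intro x
    rw [← congrFun (hφc.fourierInv_fourier_eq hφi hKi) x, Real.fourierInv_eq',
      ← integral_const_mul]
    refine integral_congr_ae (Eventually.of_forall fun ξ => ?_)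
    simp only [smul_eq_mul, RCLike.inner_apply, conj_trivial]
    push_cast
    ring_nf
  have hh' : (2 * h : ℂ) ≠ 0 := by
    exact_mod_cast (mul_pos two_pos hh0).ne'
  refine ⟨fun ξ => (2 * h : ℂ)⁻¹ * 𝓕 φ ξ, hKi.const_mul _, ?_, fun x hx => ?_, fun x hx => ?_⟩
  · have hmax : max (2 * c) ((2 * h) ^ (-θ)) ≤ (2 / θ + 1) * 2 ^ θ * (N : ℝ) ^ θ := by
      have h1 : ((N : ℝ) + 1) ^ θ ≤ 2 ^ θ * (N : ℝ) ^ θ := by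
        rw [← Real.mul_rpow (by norm_num) hN0.le]
        exact Real.rpow_le_rpow (by positivity) (by linarith) hθ.le
      have h2 : max (2 * c) ((2 * h) ^ (-θ)) ≤ (2 / θ + 1) * ((N : ℝ) + 1) ^ θ := by
        refine max_le ?_ ?_
        · have := Real.log_le_rpow_div (x := (N : ℝ) + 1) (by positivity) hθ
          have h3 : 2 * c ≤ 2 * (((N : ℝ) + 1) ^ θ / θ) := by linarith
          refine h3.trans ?_
          have : 0 ≤ ((N : ℝ) + 1) ^ θ := by positivity
          calc _ = 2 / θ * ((N : ℝ) + 1) ^ θ := by ring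
            _ ≤ _ := by gcongr; linarith
        -- The slope has width `log (1 + 1/N) ≥ 1/(N + 1)`, so `(2h)^(-θ)` costs only `(N + 1)^θ`.
        · have h3 : ((N : ℝ) + 1)⁻¹ ≤ 2 * h := by
            have := Real.one_sub_inv_le_log_of_pos (x := ((N : ℝ) + 1) / N) (by positivity)
            rw [Real.log_div (by positivity) hN0.ne', inv_div] at this
            have h4 : 1 - (N : ℝ) / (N + 1) = ((N : ℝ) + 1)⁻¹ := by field_simp; ring
            linarith
          calc (2 * h) ^ (-θ) ≤ (((N : ℝ) + 1)⁻¹) ^ (-θ) :=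
                Real.rpow_le_rpow_of_nonpos (by positivity) h3 (by linarith)
            _ = ((N : ℝ) + 1) ^ θ := by
                rw [Real.inv_rpow (by positivity), Real.rpow_neg (by positivity), inv_inv]
            _ ≤ _ := le_mul_of_one_le_left (by positivity) (by
                have : 0 < 2 / θ := by positivity
                linarith)
      calc _ ≤ _ := h2
        _ ≤ (2 / θ + 1) * (2 ^ θ * (N : ℝ) ^ θ) := by gcongr
        _ = _ := by ring
    calc ∫ ξ, ‖(2 * h : ℂ)⁻¹ * 𝓕 φ ξ‖
        ≤ ∫ ξ : ℝ, (2 * h)⁻¹ * (2 * h * (max (2 * c) ((2 * h) ^ (-θ)) * 2 ^ (1 + θ)) *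
            (1 + ‖ξ‖) ^ (-(1 + θ))) := by
          refine integral_mono_of_nonneg (Eventually.of_forall fun ξ => norm_nonneg _)
            ((hJ.const_mul _).const_mul _) (Eventually.of_forall fun ξ => ?_)
          simp only [norm_mul, norm_inv, Complex.norm_real, Complex.norm_ofNat,
            Real.norm_of_nonneg hh0.le]
          exact mul_le_mul_of_nonneg_left (hb ξ) (by positivity)
      _ = max (2 * c) ((2 * h) ^ (-θ)) * 2 ^ (1 + θ) * J := by
          rw [integral_const_mul, integral_const_mul]
          rw [← hJdef]
          field_simp
      _ ≤ (2 / θ + 1) * 2 ^ θ * (N : ℝ) ^ θ * 2 ^ (1 + θ) * J := by gcongr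
      _ = _ := by ring
  · rw [hinv, hφ, convolution_indicator_of_le hh0.le (hx.trans (by linarith)), inv_mul_cancel₀ hh']
  · rw [hinv, hφ, convolution_indicator_of_ge hh0.le (le_trans (by linarith) hx), mul_zero]

/-! ### Vertical averages and the growth of partial sums. -/

theorem tendsto_partialSum_of_LSeriesSummable {a : ℕ → ℂ} {s : ℂ} (h : LSeriesSummable a s) :
    Tendsto (partialSum a s) atTop (𝓝 (LSeries a s)) := by
  refine (h.hasSum.tendsto_sum_nat.comp (tendsto_add_atTop_nat 1)).congr fun N => ?_
  induction N with
  | zero => simp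
  | succ N ih =>
    rw [partialSum_succ, ← ih, Function.comp_apply, Function.comp_apply, Finset.sum_range_succ,
      LSeries.term_of_ne_zero (by omega), Complex.cpow_neg, div_eq_mul_inv]

theorem norm_cexp_mul_mul_I (x y z : ℝ) : ‖Complex.exp (x * y * z * Complex.I)‖ = 1 := by
  rw [show (x * y * z : ℂ) = ((x * y * z : ℝ) : ℂ) by push_cast; ring]
  exact Complex.norm_exp_ofReal_mul_I _

theorem term_add_mul_I (a : ℕ → ℂ) (s : ℂ) (r ξ : ℝ) (n : ℕ) :
    LSeries.term a (s + r * ξ * Complex.I) n =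
      LSeries.term a s n * Complex.exp (r * ξ * (-Real.log n : ℝ) * Complex.I) := by
  rcases eq_or_ne n 0 with rfl | hn
  · simp
  have hn' : (n : ℂ) ≠ 0 := Nat.cast_ne_zero.2 hn
  rw [LSeries.term_of_ne_zero hn, LSeries.term_of_ne_zero hn, Complex.cpow_add _ _ hn',
    div_mul_eq_div_div, div_eq_mul_inv (a n / _), ← Complex.cpow_neg,
    Complex.cpow_def_of_ne_zero hn' (-(r * ξ * Complex.I)), ← Complex.natCast_log]
  congr 2
  push_cast
  ring

open MeasureTheory in
/-- Averaging an absolutely convergent Dirichlet series along a vertical line multiplies its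
coefficients by a Fourier transform. -/
theorem hasSum_integral_LSeries_mul {μ : Measure ℝ} {K : ℝ → ℂ} (hK : Integrable K μ)
    {a : ℕ → ℂ} {s : ℂ} (ha : LSeriesSummable a s) (r : ℝ) :
    HasSum (fun n : ℕ => LSeries.term a s n *
        ∫ ξ : ℝ, Complex.exp (r * ξ * (-Real.log n : ℝ) * Complex.I) * K ξ ∂μ)
      (∫ ξ : ℝ, LSeries a (s + r * ξ * Complex.I) * K ξ ∂μ) := by
  have hnorm : ∀ (n : ℕ) (ξ : ℝ), ‖LSeries.term a s n *
      (Complex.exp (r * ξ * (-Real.log n : ℝ) * Complex.I) * K ξ)‖ =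
      ‖LSeries.term a s n‖ * ‖K ξ‖ := fun n ξ => by
    rw [norm_mul, norm_mul, norm_cexp_mul_mul_I, one_mul]
  have key := hasSum_integral_of_summable_integral_norm (μ := μ) (F := fun (n : ℕ) (ξ : ℝ) =>
    LSeries.term a s n * (Complex.exp (r * ξ * (-Real.log n : ℝ) * Complex.I) * K ξ)) ?_ ?_
  · simp_rw [integral_const_mul] at key
    have e : ∀ ξ : ℝ, LSeries a (s + r * ξ * Complex.I) * K ξ = ∑' n : ℕ, LSeries.term a s n *
        (Complex.exp (r * ξ * (-Real.log n : ℝ) * Complex.I) * K ξ) := fun ξ => by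
      rw [LSeries, ← tsum_mul_right]
      exact tsum_congr fun n => by rw [term_add_mul_I, mul_assoc]
    simp_rw [e]
    exact key
  · intro n
    refine Integrable.const_mul ?_ _
    refine hK.bdd_mul (c := 1) (Continuous.aestronglyMeasurable (by fun_prop)) ?_
    exact Eventually.of_forall fun ξ => (norm_cexp_mul_mul_I _ _ _).le
  · simp_rw [hnorm, integral_const_mul]
    exact ha.norm.mul_right _

-- The partial sum is the average of the series along the vertical line through `s` against the
-- cutoff kernel. That `C` depends only on `θ` is essential: the bound is applied to all smooth
-- parts at once.
open MeasureTheory in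
theorem exists_norm_partialSum_le {θ : ℝ} (hθ : 0 < θ) (hθ1 : θ ≤ 1) :
    ∃ C : ℝ, 0 ≤ C ∧ ∀ (a : ℕ → ℂ) (s : ℂ) (M : ℝ), LSeriesSummable a s →
      (∀ t : ℝ, ‖LSeries a (s + t * Complex.I)‖ ≤ M) →
      ∀ N : ℕ, ‖partialSum a s N‖ ≤ M * C * (N : ℝ) ^ θ := by
  obtain ⟨C, hC, hK⟩ := exists_cutoff_kernel hθ hθ1
  refine ⟨C, hC, fun a s M ha hM N => ?_⟩
  have hM0 : 0 ≤ M := (norm_nonneg _).trans (hM 0)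
  rcases eq_or_ne N 0 with rfl | hN
  · simp only [partialSum_zero, norm_zero]
    positivity
  obtain ⟨K, hKi, hKn, hK1, hK0⟩ := hK N hN
  have h1 := hasSum_integral_LSeries_mul hKi ha (2 * Real.pi)
  have h2 : HasSum (fun n : ℕ => LSeries.term a s n *
        ∫ ξ : ℝ, Complex.exp ((2 * Real.pi : ℝ) * ξ * (-Real.log n : ℝ) * Complex.I) * K ξ)
      (partialSum a s N) := by
    rw [partialSum]
    convert hasSum_sum_of_ne_finset_zero (s := Finset.Icc 1 N) (f := fun n : ℕ =>
      LSeries.term a s n *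
        ∫ ξ : ℝ, Complex.exp ((2 * Real.pi : ℝ) * ξ * (-Real.log n : ℝ) * Complex.I) * K ξ)
      ?_ using 1
    · refine Finset.sum_congr rfl fun n hn => ?_
      rw [Finset.mem_Icc] at hn
      have hlog : Real.log n ≤ Real.log N :=
        Real.log_le_log (by exact_mod_cast hn.1) (by exact_mod_cast hn.2)
      have := hK1 (-Real.log n) (by rwa [abs_neg, abs_of_nonneg (Real.log_natCast_nonneg _)])
      push_cast at this ⊢
      rw [this, LSeries.term_of_ne_zero (by omega), Complex.cpow_neg, mul_one, div_eq_mul_inv]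
    · intro n hn
      rcases eq_or_ne n 0 with rfl | hn0
      · simp
      have hn' : N + 1 ≤ n := by
        by_contra h
        exact hn (Finset.mem_Icc.2 ⟨Nat.one_le_iff_ne_zero.2 hn0, by omega⟩)
      have hlog : Real.log (N + 1) ≤ Real.log n :=
        Real.log_le_log (by positivity) (by exact_mod_cast hn')
      have := hK0 (-Real.log n) (by rwa [abs_neg, abs_of_nonneg (Real.log_natCast_nonneg _)])
      push_cast at this ⊢
      rw [this, mul_zero]
    · infer_instance
  rw [h2.unique h1]
  calc _ ≤ ∫ ξ : ℝ, M * ‖K ξ‖ := by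
        refine norm_integral_le_of_norm_le (hKi.norm.const_mul M)
          (Eventually.of_forall fun ξ => ?_)
        rw [norm_mul]
        gcongr
        have := hM (2 * Real.pi * ξ)
        push_cast at this ⊢
        exact this
    _ ≤ M * (C * (N : ℝ) ^ θ) := by
        rw [integral_const_mul]
        gcongr
    _ = _ := by ring

/-! ### Smooth parts and convergence on the right half-plane. -/

/-- The part of an arithmetic function that lives on the `d`-smooth numbers. -/
noncomputable def smoothPart (d : ℕ) (a : ArithmeticFunction ℂ) : ArithmeticFunction ℂ :=
  ⟨d.smoothNumbers.indicator a, by simp [Set.indicator]⟩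

theorem smoothPart_apply (d : ℕ) (a : ArithmeticFunction ℂ) (n : ℕ) :
    smoothPart d a n = d.smoothNumbers.indicator a n := rfl

theorem smoothPart_of_lt {d n : ℕ} (a : ArithmeticFunction ℂ) (h : n < d) :
    smoothPart d a n = a n := by
  rcases eq_or_ne n 0 with rfl | hn
  · simp
  · rw [smoothPart_apply, Set.indicator_of_mem (Nat.mem_smoothNumbers_of_lt (by omega) h)]

theorem smoothPart_one (d : ℕ) : smoothPart d 1 = 1 := by
  ext n
  rw [smoothPart_apply, Set.indicator_apply_eq_self]
  intro hn
  refine ArithmeticFunction.one_apply_ne ?_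
  rintro rfl
  exact hn (by simp [Nat.mem_smoothNumbers])

/-- A product is `d`-smooth exactly when both factors are, so no term of the convolution mixes
smooth and non-smooth numbers. -/
theorem smoothPart_mul (d : ℕ) (a b : ArithmeticFunction ℂ) :
    smoothPart d (a * b) = smoothPart d a * smoothPart d b := by
  ext n
  rw [smoothPart_apply, ArithmeticFunction.mul_apply]
  by_cases hn : n ∈ d.smoothNumbers
  · rw [Set.indicator_of_mem hn, ArithmeticFunction.mul_apply]
    refine Finset.sum_congr rfl fun x hx => ?_
    have h1 := (Nat.mem_divisorsAntidiagonal.1 hx).1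
    rw [smoothPart_apply, smoothPart_apply,
      Set.indicator_of_mem (Nat.mem_smoothNumbers_of_dvd hn (Dvd.intro _ h1)),
      Set.indicator_of_mem (Nat.mem_smoothNumbers_of_dvd hn (Dvd.intro_left _ h1))]
  · rw [Set.indicator_of_notMem hn]
    refine (Finset.sum_eq_zero fun x hx => ?_).symm
    have h1 := (Nat.mem_divisorsAntidiagonal.1 hx).1
    rw [smoothPart_apply, smoothPart_apply]
    by_cases h2 : x.1 ∈ d.smoothNumbers
    · rw [Set.indicator_of_notMem (s := d.smoothNumbers) (a := x.2) fun h3 =>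
        hn (h1 ▸ Nat.mul_mem_smoothNumbers h2 h3), mul_zero]
    · rw [Set.indicator_of_notMem h2, zero_mul]

theorem smoothPart_pow (d : ℕ) (a : ArithmeticFunction ℂ) (k : ℕ) :
    smoothPart d (a ^ k) = smoothPart d a ^ k := by
  induction k with
  | zero => simp [smoothPart_one]
  | succ k ih => rw [pow_succ, pow_succ, smoothPart_mul, ih]

/-- A finite Euler product: only the primes below `d` occur, and each geometric series converges as
soon as `x > 0`. -/
theorem summable_indicator_smoothNumbers (d : ℕ) {x : ℝ} (hx : 0 < x) :
    Summable (d.smoothNumbers.indicator fun n : ℕ => (n : ℝ) ^ (-x)) := by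
  let f : ℕ →* ℝ :=
    { toFun := fun n => (n : ℝ) ^ (-x)
      map_one' := by simp
      map_mul' := fun m n => by
        rw [Nat.cast_mul, Real.mul_rpow (Nat.cast_nonneg _) (Nat.cast_nonneg _)] }
  have h := (EulerProduct.summable_and_hasSum_smoothNumbers_prod_primesBelow_geometric (f := f)
    (fun {p} hp => by
      have : (1 : ℝ) < p := by exact_mod_cast hp.one_lt
      simp only [f, MonoidHom.coe_mk, OneHom.coe_mk]
      rw [Real.norm_of_nonneg (by positivity)]
      exact Real.rpow_lt_one_of_one_lt_of_neg this (by linarith)) d).2.summable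
  exact (summable_subtype_iff_indicator (f := fun n : ℕ => (n : ℝ) ^ (-x))).1 h

/-- Cauchy–Schwarz for a Dirichlet series with square-summable coefficients. -/
theorem LSeries_indicator_le {c : ℕ → ℂ} (hc : Summable fun n => ‖c n‖ ^ 2) {E : Set ℕ} {s : ℂ}
    (hE : Summable (E.indicator fun n : ℕ => (n : ℝ) ^ (-(2 * s.re)))) :
    LSeriesSummable (E.indicator c) s ∧ ‖LSeries (E.indicator c) s‖ ≤
      √(∑' n, ‖c n‖ ^ 2) * √(∑' n, E.indicator (fun n : ℕ => (n : ℝ) ^ (-(2 * s.re))) n) := by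
  have hsq : ∀ n : ℕ, E.indicator (fun n : ℕ => (n : ℝ) ^ (-s.re)) n ^ (2 : ℝ) =
      E.indicator (fun n : ℕ => (n : ℝ) ^ (-(2 * s.re))) n := by
    intro n
    by_cases hn : n ∈ E
    · simp only [hn, Set.indicator_of_mem]
      rw [← Real.rpow_mul (Nat.cast_nonneg _)]
      ring_nf
    · simp [hn]
  have hle : ∀ n : ℕ, ‖LSeries.term (E.indicator c) s n‖ ≤
      ‖c n‖ * E.indicator (fun n : ℕ => (n : ℝ) ^ (-s.re)) n := by
    intro n
    rcases eq_or_ne n 0 with rfl | hn0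
    · simp only [LSeries.term_zero, norm_zero]
      exact mul_nonneg (norm_nonneg _) (Set.indicator_nonneg (fun n _ => by positivity) _)
    rw [LSeries.norm_term_eq, if_neg hn0]
    by_cases hn : n ∈ E
    · simp only [hn, Set.indicator_of_mem]
      rw [Real.rpow_neg (Nat.cast_nonneg _), div_eq_mul_inv]
    · simp [hn]
  have key := Real.summable_and_inner_le_Lp_mul_Lq_tsum_of_nonneg Real.HolderConjugate.two_two
    (f := fun n => ‖c n‖) (g := E.indicator fun n : ℕ => (n : ℝ) ^ (-s.re))
    (fun n => norm_nonneg _) (fun n => Set.indicator_nonneg (fun n _ => by positivity) _)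
    (by simpa using hc) (by simpa only [hsq] using hE)
  simp only [hsq, Real.rpow_two, ← Real.sqrt_eq_rpow] at key
  refine ⟨.of_norm_bounded key.1 hle, ?_⟩
  exact (tsum_of_norm_bounded key.1.hasSum hle).trans key.2

/-- The power trick: a constant independent of the exponent disappears on taking `k`-th roots. -/
theorem le_of_forall_pow_le {x M W : ℝ} (hM : 0 ≤ M) (h : ∀ k : ℕ, x ^ k ≤ M ^ k * W) : x ≤ M := by
  by_contra! hx
  have hx0 : 0 < x := hM.trans_lt hx
  have h1 : Tendsto (fun k : ℕ => (M / x) ^ k * W) atTop (𝓝 (0 * W)) :=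
    (tendsto_pow_atTop_nhds_zero_of_lt_one (by positivity) ((div_lt_one hx0).2 hx)).mul_const W
  rw [zero_mul] at h1
  have h2 : (1 : ℝ) ≤ 0 := ge_of_tendsto' h1 fun k => by
    rw [div_pow, div_mul_eq_mul_div, le_div_iff₀ (by positivity), one_mul]
    exact h k
  norm_num at h2

theorem LSeriesSummable_pow {a : ArithmeticFunction ℂ} {s : ℂ}
    (h : LSeriesSummable (fun n => a n) s) (k : ℕ) :
    LSeriesSummable (fun n => (a ^ k) n) s ∧
      LSeries (fun n => (a ^ k) n) s = LSeries (fun n => a n) s ^ k := by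
  induction k with
  | zero =>
    have h1 : ∀ n : ℕ, (1 : ArithmeticFunction ℂ) n = LSeries.delta n := by
      intro n; simp [ArithmeticFunction.one_apply, LSeries.delta]
    simp only [pow_zero]
    refine ⟨?_, ?_⟩
    · refine summable_of_ne_finset_zero (s := {1}) fun n hn => ?_
      simp only [h1, LSeries.term_delta]
      simpa using hn
    · rw [LSeries_congr (g := LSeries.delta) (fun {n} _ => h1 n), LSeries_delta]
      rfl
  | succ k ih =>
    simp only [pow_succ]
    exact ⟨ArithmeticFunction.LSeriesSummable_mul ih.1 h, by
      rw [ArithmeticFunction.LSeries_mul' ih.1 h, ih.2]⟩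

/-- If the powers of a Dirichlet series have norms `O(Mᵏ)` in `𝓗²`, then the part of the series
that lives on smooth numbers converges absolutely on `Re s > 0` and is bounded by `M` there. -/
theorem norm_LSeries_smoothPart_le {a : ArithmeticFunction ℂ} {M : ℝ} (hM : 0 ≤ M)
    (h : ∀ k : ℕ, Summable (fun n => ‖(a ^ k) n‖ ^ 2) ∧ √(∑' n, ‖(a ^ k) n‖ ^ 2) ≤ M ^ k)
    (d : ℕ) {s : ℂ} (hs : 0 < s.re) :
    LSeriesSummable (fun n => smoothPart d a n) s ∧
      ‖LSeries (fun n => smoothPart d a n) s‖ ≤ M := by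
  have hE := summable_indicator_smoothNumbers d (x := 2 * s.re) (by linarith)
  have h1 : LSeriesSummable (fun n => smoothPart d a n) s := by
    have := (LSeries_indicator_le (h 1).1 hE).1
    rwa [pow_one] at this
  refine ⟨h1, le_of_forall_pow_le (W := √(∑' n, d.smoothNumbers.indicator
    (fun n : ℕ => (n : ℝ) ^ (-(2 * s.re))) n)) hM fun k => ?_⟩
  rw [← norm_pow, ← (LSeriesSummable_pow h1 k).2, ← smoothPart_pow]
  exact (LSeries_indicator_le (h k).1 hE).2.trans (by gcongr; exact (h k).2)

/-- The smooth parts are bounded by `M`, and their partial sums are controlled uniformly in `d`;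
hence both convergence and the bound survive `d → ∞`. -/
theorem exists_tendsto_partialSum {a : ArithmeticFunction ℂ} {M : ℝ} (hM : 0 ≤ M)
    (h : ∀ k : ℕ, Summable (fun n => ‖(a ^ k) n‖ ^ 2) ∧ √(∑' n, ‖(a ^ k) n‖ ^ 2) ≤ M ^ k)
    {s : ℂ} (hs : 0 < s.re) :
    ∃ z : ℂ, ‖z‖ ≤ M ∧ Tendsto (partialSum a s) atTop (𝓝 z) := by
  -- Partial sums are estimated at `s - w` with `w = Re s / 2`, still in the half-plane; Abel
  -- summation back to `s` needs a growth exponent below `Re w`, and the kernels need one at most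
  -- `1`.
  have hθ : 0 < min 1 (s.re / 4) := lt_min one_pos (by linarith)
  obtain ⟨C, hC, hK⟩ := exists_norm_partialSum_le hθ (min_le_left _ _)
  set w : ℂ := ((s.re / 2 : ℝ) : ℂ) with hw
  have hwre : w.re = s.re / 2 := Complex.ofReal_re _
  have hre : 0 < (s - w).re := by rw [Complex.sub_re, hwre]; linarith
  have hθw : min 1 (s.re / 4) < w.re := by
    rw [hwre]
    exact (min_le_right _ _).trans_lt (by linarith)
  have hbd : ∀ d N : ℕ, ‖partialSum (smoothPart d a) (s - w) N‖ ≤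
      M * C * (N : ℝ) ^ (min 1 (s.re / 4)) := by
    intro d N
    exact hK _ _ M (norm_LSeries_smoothPart_le hM h d hre).1
      (fun t => (norm_LSeries_smoothPart_le hM h d (by simpa using hre)).2) N
  have heq : ∀ d N : ℕ, N < d → partialSum (smoothPart d a) (s - w) N = partialSum a (s - w) N := by
    intro d N hd
    refine Finset.sum_congr rfl fun n hn => ?_
    rw [smoothPart_of_lt a ((Finset.mem_Icc.1 hn).2.trans_lt hd)]
  have hbd' : ∀ N : ℕ, ‖partialSum a (s - w) N‖ ≤ M * C * (N : ℝ) ^ (min 1 (s.re / 4)) :=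
    fun N => heq (N + 1) N N.lt_succ_self ▸ hbd (N + 1) N
  have h1 := tendsto_partialSum_add hθ.le hθw hbd'
  rw [sub_add_cancel] at h1
  refine ⟨_, ?_, h1⟩
  have h2 : ∀ d : ℕ, ‖∑' n, partialSum (smoothPart d a) (s - w) n * abelWeight w n‖ ≤ M := by
    intro d
    have h3 := tendsto_partialSum_add hθ.le hθw (hbd d)
    rw [sub_add_cancel] at h3
    obtain ⟨h4, h5⟩ := norm_LSeries_smoothPart_le hM h d hs
    rwa [tendsto_nhds_unique h3 (tendsto_partialSum_of_LSeriesSummable h4)]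
  -- Each term of the Abel-summed series is eventually constant in `d`, and the majorant does not
  -- depend on `d`.
  refine le_of_tendsto' (tendsto_tsum_of_dominated_convergence (𝓕 := atTop)
    ((summable_rpow_sub_one (x := min 1 (s.re / 4) - w.re) (by linarith)).mul_left
      (M * C * ‖w‖)) (fun n => ?_) (Eventually.of_forall fun d n =>
        norm_mul_abelWeight_le (hθ.trans hθw) (hbd d) n)).norm h2
  refine tendsto_const_nhds.congr' ?_
  filter_upwards [eventually_gt_atTop n] with d hd
  rw [heq d n hd]

/-! ### Products, supports and membership in `𝓗²_S`. -/

theorem LSeriesSummable_of_summable_sq {a : ℕ → ℂ} (ha : Summable fun n => ‖a n‖ ^ 2) {s : ℂ}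
    (hs : 1 / 2 < s.re) : LSeriesSummable a s := by
  have := (LSeries_indicator_le ha (E := Set.univ) (s := s) (by
    simpa only [Set.indicator_univ] using Real.summable_nat_rpow.2 (by linarith))).1
  simpa only [Set.indicator_univ] using this

theorem hasDirichletSeries_LSeries {σ : ℝ} {a : ArithmeticFunction ℂ}
    (ha : ∀ s : halfPlane σ, LSeriesSummable (fun n => a n) s) :
    HasDirichletSeries (fun s : halfPlane σ => LSeries (fun n => a n) s) a :=
  fun s => tendsto_partialSum_of_LSeriesSummable (ha s)

theorem HasDirichletSeries.mul {σ : ℝ} {f g : halfPlane σ → ℂ} {a b : ArithmeticFunction ℂ}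
    (hf : HasDirichletSeries f a) (hg : HasDirichletSeries g b)
    (ha : ∀ s : halfPlane σ, LSeriesSummable (fun n => a n) s)
    (hb : ∀ s : halfPlane σ, LSeriesSummable (fun n => b n) s) :
    HasDirichletSeries (f * g) (a * b) := by
  intro s
  have := tendsto_partialSum_of_LSeriesSummable
    (ArithmeticFunction.LSeriesSummable_mul (ha s) (hb s))
  rwa [ArithmeticFunction.LSeries_mul' (ha s) (hb s), eq_LSeries hf s (ha s),
    eq_LSeries hg s (hb s)] at this

theorem SupportedOn.mul {S : Subsemigroup ℕ+} {a b : ArithmeticFunction ℂ}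
    (ha : SupportedOn S a) (hb : SupportedOn S b) : SupportedOn (S : Set ℕ+) (a * b) := by
  intro n hn
  rw [ArithmeticFunction.mul_apply]
  refine Finset.sum_eq_zero fun x hx => ?_
  obtain ⟨h1, -⟩ := Nat.mem_divisorsAntidiagonal.1 hx
  have h0 : x.1 ≠ 0 ∧ x.2 ≠ 0 := mul_ne_zero_iff.1 (h1 ▸ n.ne_zero)
  lift x.1 to ℕ+ using Nat.pos_of_ne_zero h0.1 with p hp
  lift x.2 to ℕ+ using Nat.pos_of_ne_zero h0.2 with q hq
  by_cases h2 : p ∈ S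
  · rw [hb q fun h3 => hn ?_, mul_zero]
    have : p * q = n := PNat.coe_injective (by simpa using h1)
    exact this ▸ S.mul_mem h2 h3
  · rw [ha p h2, zero_mul]

theorem supportedOn_one {S : Set ℕ+} (hS : 1 ∈ S) : SupportedOn S 1 := by
  intro n hn
  refine ArithmeticFunction.one_apply_ne fun h => hn ?_
  rwa [show n = 1 from PNat.coe_injective h]

theorem hasSum_sq_one : HasSum (fun n => ‖(1 : ArithmeticFunction ℂ) n‖ ^ 2) 1 := by
  convert hasSum_ite_eq 1 (1 : ℝ) using 2 with n
  rw [ArithmeticFunction.one_apply]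
  split_ifs <;> simp

theorem hasDirichletSeries_one (σ : ℝ) : HasDirichletSeries (1 : halfPlane σ → ℂ) 1 := by
  intro s
  refine tendsto_const_nhds.congr' ?_
  filter_upwards [eventually_ge_atTop 1] with N hN
  rw [Finset.sum_eq_single_of_mem 1 (Finset.mem_Icc.2 ⟨le_rfl, hN⟩)]
  · simp
  · intro n _ hn
    rw [ArithmeticFunction.one_apply_ne hn, zero_mul]

theorem one_mem_H2 {S : Set ℕ+} (hS : 1 ∈ S) : 1 ∈ H2 S :=
  ⟨1, supportedOn_one hS, hasSum_sq_one.summable, hasDirichletSeries_one _⟩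

theorem LSeries_mem_H2 {S : Set ℕ+} {b : ArithmeticFunction ℂ} (hb : SupportedOn S b)
    (hb2 : Summable fun n => ‖b n‖ ^ 2) :
    (fun s : halfPlane (1 / 2) => LSeries (fun n => b n) s) ∈ H2 S ∧
      HasDirichletSeries (fun s : halfPlane (1 / 2) => LSeries (fun n => b n) s) b := by
  have h := hasDirichletSeries_LSeries (σ := 1 / 2) (a := b)
    fun s => LSeriesSummable_of_summable_sq hb2 s.2
  exact ⟨⟨b, hb, hb2, h⟩, h⟩

/-! ### From multipliers to bounded Dirichlet series. -/

theorem memlp_two_iff {x : ℕ → ℂ} : Memℓp x 2 ↔ Summable fun n => ‖x n‖ ^ 2 := by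
  rw [memℓp_gen_iff (by norm_num)]
  simp

theorem norm_lp_two (x : lp (fun _ : ℕ => ℂ) 2) : ‖x‖ = √(∑' n, ‖x n‖ ^ 2) := by
  rw [lp.norm_eq_tsum_rpow (by norm_num), Real.sqrt_eq_rpow]
  simp

open Classical in
/-- The arithmetic function that agrees with `x` on `S` and vanishes elsewhere. -/
noncomputable def restrictTo (S : Set ℕ+) (x : ℕ → ℂ) : ArithmeticFunction ℂ :=
  ⟨fun n => if ∃ m ∈ S, (m : ℕ) = n then x n else 0, by simp⟩

open Classical in
theorem restrictTo_apply (S : Set ℕ+) (x : ℕ → ℂ) (n : ℕ) :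
    restrictTo S x n = if ∃ m ∈ S, (m : ℕ) = n then x n else 0 := rfl

theorem supportedOn_restrictTo (S : Set ℕ+) (x : ℕ → ℂ) : SupportedOn S (restrictTo S x) := by
  intro n hn
  rw [restrictTo_apply, if_neg]
  rintro ⟨m, hm, hmn⟩
  exact hn (PNat.coe_injective hmn ▸ hm)

theorem norm_restrictTo_le (S : Set ℕ+) (x : ℕ → ℂ) (n : ℕ) : ‖restrictTo S x n‖ ≤ ‖x n‖ := by
  rw [restrictTo_apply]
  split_ifs <;> simp

theorem SupportedOn.restrictTo_eq {S : Set ℕ+} {b : ArithmeticFunction ℂ} (hb : SupportedOn S b) :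
    restrictTo S b = b := by
  ext n
  rw [restrictTo_apply]
  split_ifs with h
  · rfl
  · rcases eq_or_ne n 0 with rfl | hn
    · simp
    · lift n to ℕ+ using Nat.pos_of_ne_zero hn
      exact (hb n fun h1 => h ⟨n, h1, rfl⟩).symm

/-- `M` bounds the Dirichlet convolution with `a` on the square-summable sequences on `S`. -/
def ConvolutionBound (S : Set ℕ+) (a : ArithmeticFunction ℂ) (M : ℝ) : Prop :=
  ∀ b : ArithmeticFunction ℂ, SupportedOn S b → (Summable fun n => ‖b n‖ ^ 2) →
    (Summable fun n => ‖(a * b) n‖ ^ 2) ∧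
      √(∑' n, ‖(a * b) n‖ ^ 2) ≤ M * √(∑' n, ‖b n‖ ^ 2)

/-- The closed graph theorem for Dirichlet convolution on square-summable sequences. -/
theorem exists_convolutionBound {S : Set ℕ+} {a : ArithmeticFunction ℂ}
    (h : ∀ b : ArithmeticFunction ℂ, SupportedOn S b → (Summable fun n => ‖b n‖ ^ 2) →
      Summable fun n => ‖(a * b) n‖ ^ 2) :
    ∃ M, 0 ≤ M ∧ ConvolutionBound S a M := by
  have hsum : ∀ x : lp (fun _ : ℕ => ℂ) 2, Summable fun n => ‖restrictTo S x n‖ ^ 2 := fun x =>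
    (memlp_two_iff.1 x.2).of_nonneg_of_le (fun n => by positivity) fun n => by
      gcongr
      exact norm_restrictTo_le S x n
  -- Projecting onto `S` before convolving defines the operator on all of `ℓ²`, so no closed
  -- subspace has to be handled.
  let T : lp (fun _ : ℕ => ℂ) 2 →ₗ[ℂ] lp (fun _ : ℕ => ℂ) 2 :=
    { toFun := fun x => ⟨fun n => (a * restrictTo S x) n,
        memlp_two_iff.2 (h _ (supportedOn_restrictTo S x) (hsum x))⟩
      map_add' := fun x y => by
        ext n
        simp only [lp.coeFn_add, Pi.add_apply, ArithmeticFunction.mul_apply,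
          ← Finset.sum_add_distrib]
        refine Finset.sum_congr rfl fun p _ => ?_
        simp only [restrictTo_apply, Pi.add_apply]
        split_ifs <;> ring
      map_smul' := fun c x => by
        ext n
        simp only [lp.coeFn_smul, Pi.smul_apply, ArithmeticFunction.mul_apply, RingHom.id_apply,
          Finset.smul_sum]
        refine Finset.sum_congr rfl fun p _ => ?_
        simp only [restrictTo_apply, Pi.smul_apply, smul_eq_mul]
        split_ifs <;> ring }
  have happ : ∀ x n, T x n = (a * restrictTo S x) n := fun x n => rfl
  have hcoord : ∀ n : ℕ, Continuous fun x : lp (fun _ : ℕ => ℂ) 2 => x n := fun n =>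
    (continuous_apply n).comp (lp.uniformContinuous_coe).continuous
  have hT : Continuous T := by
    -- The graph is closed because each coordinate of a convolution is a finite sum of continuous
    -- coordinates.
    refine T.continuous_of_seq_closed_graph fun u x y hu hTu => ?_
    ext n
    refine tendsto_nhds_unique (((hcoord n).tendsto y).comp hTu) ?_
    simp only [Function.comp_def, happ, ArithmeticFunction.mul_apply]
    refine tendsto_finsetSum _ fun p _ => ?_
    refine Tendsto.const_mul _ ?_
    simp only [restrictTo_apply]
    split_ifs
    · exact ((hcoord _).tendsto x).comp hu
    · exact tendsto_const_nhds
  refine ⟨‖(⟨T, hT⟩ : lp (fun _ : ℕ => ℂ) 2 →L[ℂ] lp (fun _ : ℕ => ℂ) 2)‖, norm_nonneg _,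
    fun b hb hb2 => ⟨h b hb hb2, ?_⟩⟩
  have h1 := ContinuousLinearMap.le_opNorm
    (⟨T, hT⟩ : lp (fun _ : ℕ => ℂ) 2 →L[ℂ] lp (fun _ : ℕ => ℂ) 2)
    ⟨fun n => b n, memlp_two_iff.2 hb2⟩
  rw [norm_lp_two, norm_lp_two] at h1
  have h2 : restrictTo S (fun n => b n) = b := hb.restrictTo_eq
  simpa only [ContinuousLinearMap.coe_mk', happ, h2] using h1

theorem ConvolutionBound.pow {S : Subsemigroup ℕ+} (hS : 1 ∈ S) {a : ArithmeticFunction ℂ}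
    (ha : SupportedOn S a) {M : ℝ} (hM : 0 ≤ M) (h : ConvolutionBound (S : Set ℕ+) a M) (k : ℕ) :
    SupportedOn (S : Set ℕ+) (a ^ k) ∧
      Summable (fun n => ‖(a ^ k) n‖ ^ 2) ∧ √(∑' n, ‖(a ^ k) n‖ ^ 2) ≤ M ^ k := by
  induction k with
  | zero =>
    simp only [pow_zero]
    exact ⟨supportedOn_one hS, hasSum_sq_one.summable, by rw [hasSum_sq_one.tsum_eq]; simp⟩
  | succ k ih =>
    rw [pow_succ' a, pow_succ' M]
    obtain ⟨h1, h2⟩ := h _ ih.1 ih.2.1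
    exact ⟨ha.mul ih.1, h1, h2.trans (by gcongr; exact ih.2.2)⟩

theorem ConvolutionBound.exists_hasDirichletSeries {S : Subsemigroup ℕ+} (hS : 1 ∈ S)
    {a : ArithmeticFunction ℂ} (ha : SupportedOn S a) {M : ℝ} (hM : 0 ≤ M)
    (h : ConvolutionBound (S : Set ℕ+) a M) :
    ∃ F : halfPlane 0 → ℂ, HasDirichletSeries F a ∧ ∀ s, ‖F s‖ ≤ M := by
  choose F hF1 hF2 using fun s : halfPlane 0 =>
    exists_tendsto_partialSum hM (fun k => (h.pow hS ha hM k).2) s.2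
  exact ⟨F, hF2, hF1⟩

/-- Testing on the constant `1` produces `a`; uniqueness of coefficients then identifies those of `f
* g` with `a * b`. -/
theorem exists_coeff_of_multiplier {S : Set ℕ+} (hS : 1 ∈ S) {f : halfPlane (1 / 2) → ℂ}
    (h : ∀ g ∈ H2 S, f * g ∈ H2 S) :
    ∃ a : ArithmeticFunction ℂ, SupportedOn S a ∧ HasDirichletSeries f a ∧
      ∀ b : ArithmeticFunction ℂ, SupportedOn S b → (Summable fun n => ‖b n‖ ^ 2) →
        Summable fun n => ‖(a * b) n‖ ^ 2 := by
  obtain ⟨a, ha, ha2, hfa⟩ := h 1 (one_mem_H2 hS)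
  rw [mul_one] at hfa
  refine ⟨a, ha, hfa, fun b hb hb2 => ?_⟩
  obtain ⟨hg, hgb⟩ := LSeries_mem_H2 hb hb2
  obtain ⟨c, -, hc2, hfc⟩ := h _ hg
  rwa [← hfc.unique (hfa.mul hgb (fun s => LSeriesSummable_of_summable_sq ha2 s.2)
    fun s => LSeriesSummable_of_summable_sq hb2 s.2)]

theorem exists_extension_of_multiplier {S : Subsemigroup ℕ+} (hS : 1 ∈ S)
    {f : halfPlane (1 / 2) → ℂ} (h : ∀ g ∈ H2 (S : Set ℕ+), f * g ∈ H2 (S : Set ℕ+)) :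
    ∃ F ∈ HInfty (S : Set ℕ+), Extends F f := by
  obtain ⟨a, ha, hfa, hab⟩ := exists_coeff_of_multiplier hS h
  obtain ⟨M, hM, hMb⟩ := exists_convolutionBound hab
  obtain ⟨F, hF, hFM⟩ := hMb.exists_hasDirichletSeries hS ha hM
  exact ⟨F, ⟨a, ha, hF, M, by rintro _ ⟨s, rfl⟩; exact hFM s⟩,
    fun s h₀ h => tendsto_nhds_unique (hF ⟨s, h₀⟩) (hfa ⟨s, h⟩)⟩

/-! ### Gaussian means and Parseval's formula on the imaginary axis. -/

open MeasureTheory ProbabilityTheory in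
theorem integral_cexp_gaussianReal (v : NNReal) (x : ℝ) :
    ∫ ξ : ℝ, Complex.exp (ξ * x * Complex.I) ∂gaussianReal 0 v =
      (Real.exp (-(v * x ^ 2 / 2)) : ℂ) := by
  have h := charFun_gaussianReal (μ := 0) (v := v) x
  rw [charFun_apply_real] at h
  simp_rw [mul_comm (x : ℂ)] at h
  rw [h]
  push_cast
  congr 1
  ring

theorem term_mul_I (a : ArithmeticFunction ℂ) (ξ : ℝ) (n : ℕ) :
    LSeries.term (fun n => a n) (ξ * Complex.I) n =
      a n * Complex.exp (ξ * (-Real.log n : ℝ) * Complex.I) := by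
  have h := term_add_mul_I (fun n => a n) 0 1 ξ n
  simp only [zero_add, Complex.ofReal_one, one_mul] at h
  rw [h]
  rcases eq_or_ne n 0 with rfl | hn
  · simp
  · rw [LSeries.term_of_ne_zero hn, Complex.cpow_zero, div_one]

theorem norm_cexp_mul_I (x y : ℝ) : ‖Complex.exp (x * y * Complex.I)‖ = 1 := by
  simpa using norm_cexp_mul_mul_I 1 x y

theorem norm_term_mul_I (a : ArithmeticFunction ℂ) (ξ : ℝ) (n : ℕ) :
    ‖LSeries.term (fun n => a n) (ξ * Complex.I) n‖ = ‖a n‖ := by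
  rw [term_mul_I, norm_mul, norm_cexp_mul_I, mul_one]

theorem LSeriesSummable_mul_I_iff {a : ArithmeticFunction ℂ} {ξ : ℝ} :
    LSeriesSummable (fun n => a n) (ξ * Complex.I) ↔ Summable fun n => ‖a n‖ := by
  rw [LSeriesSummable, ← summable_norm_iff]
  simp_rw [norm_term_mul_I]

theorem continuous_LSeries_mul_I {a : ArithmeticFunction ℂ} (ha : Summable fun n => ‖a n‖) :
    Continuous fun ξ : ℝ => LSeries (fun n => a n) (ξ * Complex.I) := by
  refine continuous_tsum (fun n => ?_) ha fun n ξ => (norm_term_mul_I a ξ n).le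
  simp_rw [term_mul_I]
  fun_prop

theorem norm_LSeries_mul_I_le {a : ArithmeticFunction ℂ} (ha : Summable fun n => ‖a n‖) (ξ : ℝ) :
    ‖LSeries (fun n => a n) (ξ * Complex.I)‖ ≤ ∑' n, ‖a n‖ :=
  tsum_of_norm_bounded ha.hasSum fun n => (norm_term_mul_I a ξ n).le

-- Expand the square as an absolutely convergent double series and integrate termwise; each pair
-- contributes a value of the Gaussian characteristic function.
open MeasureTheory ProbabilityTheory ComplexConjugate in
theorem integral_norm_sq_LSeries {a : ArithmeticFunction ℂ} (ha : Summable fun n => ‖a n‖)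
    (v : NNReal) :
    ((∫ ξ : ℝ, ‖LSeries (fun n => a n) (ξ * Complex.I)‖ ^ 2 ∂gaussianReal 0 v : ℝ) : ℂ) =
      ∑' p : ℕ × ℕ, a p.1 * conj (a p.2) *
        (Real.exp (-(v * (Real.log p.2 - Real.log p.1) ^ 2 / 2)) : ℂ) := by
  have hnorm : ∀ (p : ℕ × ℕ) (ξ : ℝ), ‖a p.1 * conj (a p.2) *
      Complex.exp (ξ * (Real.log p.2 - Real.log p.1 : ℝ) * Complex.I)‖ = ‖a p.1‖ * ‖a p.2‖ := by
    intro p ξ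
    rw [norm_mul, norm_cexp_mul_I, mul_one, norm_mul, RCLike.norm_conj]
  have key := hasSum_integral_of_summable_integral_norm (μ := gaussianReal 0 v)
    (F := fun (p : ℕ × ℕ) (ξ : ℝ) => a p.1 * conj (a p.2) *
      Complex.exp (ξ * (Real.log p.2 - Real.log p.1 : ℝ) * Complex.I)) ?_ ?_
  · simp_rw [integral_const_mul, integral_cexp_gaussianReal] at key
    rw [key.tsum_eq, ← integral_complex_ofReal]
    refine integral_congr_ae (Eventually.of_forall fun ξ => ?_)
    have hs := (LSeriesSummable_mul_I_iff (ξ := ξ)).2 ha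
    simp only
    push_cast
    rw [← Complex.ofReal_pow, ← Complex.normSq_eq_norm_sq, ← Complex.mul_conj, LSeries,
      Complex.conj_tsum, tsum_mul_tsum_of_summable_norm hs.norm (by simpa using hs.norm)]
    refine tsum_congr fun p => ?_
    rw [term_mul_I, term_mul_I, map_mul, ← Complex.exp_conj, mul_mul_mul_comm, ← Complex.exp_add]
    congr 2
    simp only [map_mul, Complex.conj_ofReal, Complex.conj_I]
    push_cast
    ring
  · intro p
    refine Integrable.of_bound (C := ‖a p.1‖ * ‖a p.2‖)
      (Continuous.aestronglyMeasurable (by fun_prop)) (Eventually.of_forall fun ξ => ?_)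
    exact (hnorm p ξ).le
  · simp_rw [hnorm]
    simpa using ha.mul_of_nonneg ha (fun _ => norm_nonneg _) (fun _ => norm_nonneg _)

open MeasureTheory ProbabilityTheory ComplexConjugate in
/-- Parseval's formula for the Gaussian means of an absolutely convergent Dirichlet series. -/
theorem tendsto_integral_norm_sq_LSeries {a : ArithmeticFunction ℂ}
    (ha : Summable fun n => ‖a n‖) :
    Tendsto (fun v : NNReal => ∫ ξ : ℝ, ‖LSeries (fun n => a n) (ξ * Complex.I)‖ ^ 2
      ∂gaussianReal 0 v) atTop (𝓝 (∑' n, ‖a n‖ ^ 2)) := by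
  have hp := ha.mul_of_nonneg ha (fun _ => norm_nonneg _) (fun _ => norm_nonneg _)
  have h1 : Tendsto (fun v : NNReal => ∑' p : ℕ × ℕ, a p.1 * conj (a p.2) *
        (Real.exp (-(v * (Real.log p.2 - Real.log p.1) ^ 2 / 2)) : ℂ)) atTop
      (𝓝 (∑' p : ℕ × ℕ, if p.1 = p.2 then (‖a p.1‖ ^ 2 : ℂ) else 0)) := by
    refine tendsto_tsum_of_dominated_convergence hp (fun p => ?_)
      (Eventually.of_forall fun v p => ?_)
    · split_ifs with h
      · rw [h, sub_self]
        simp [Complex.mul_conj, Complex.normSq_eq_norm_sq]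
      -- The index `0` is set apart because `Real.log 0 = Real.log 1`: such pairs do not decay, but
      -- their coefficient is zero.
      · rcases eq_or_ne p.1 0 with h0 | h0
        · simp [h0]
        rcases eq_or_ne p.2 0 with h0' | h0'
        · simp [h0']
        have hlog : 0 < (Real.log p.2 - Real.log p.1) ^ 2 / 2 := by
          have : Real.log p.2 - Real.log p.1 ≠ 0 := sub_ne_zero.2 fun h1 => h (by
            have := Real.log_injOn_pos (Set.mem_Ioi.2 (by positivity))
              (Set.mem_Ioi.2 (by positivity)) h1
            exact_mod_cast this.symm)
          positivity
        have h2 : Tendsto (fun v : NNReal =>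
            Real.exp (-(v * (Real.log p.2 - Real.log p.1) ^ 2 / 2))) atTop (𝓝 0) := by
          refine Real.tendsto_exp_neg_atTop_nhds_zero.comp ?_
          simp_rw [mul_div_assoc]
          exact (NNReal.tendsto_coe_atTop.2 tendsto_id).atTop_mul_const hlog
        simpa using ((Complex.continuous_ofReal.tendsto 0).comp h2).const_mul
          (a p.1 * conj (a p.2))
    · rw [norm_mul, norm_mul, RCLike.norm_conj, Complex.norm_real,
        Real.norm_of_nonneg (Real.exp_pos _).le]
      refine mul_le_of_le_one_right (by positivity) (Real.exp_le_one_iff.2 ?_)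
      rw [neg_nonpos]
      positivity
  have h2 : ∑' p : ℕ × ℕ, (if p.1 = p.2 then (‖a p.1‖ ^ 2 : ℂ) else 0) =
      ((∑' n, ‖a n‖ ^ 2 : ℝ) : ℂ) := by
    rw [Summable.tsum_prod' (.of_norm_bounded hp fun p => ?_) fun n => ?_]
    · push_cast
      refine tsum_congr fun n => ?_
      simp
    · split_ifs with h
      · simp [h, sq]
      · simp only [norm_zero]
        positivity
    · exact summable_of_ne_finset_zero (s := {n}) fun m hm => by
        simp only [Finset.mem_singleton] at hm
        simp [Ne.symm hm]
  rw [h2] at h1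
  simp_rw [← integral_norm_sq_LSeries ha] at h1
  exact (Complex.continuous_re.tendsto _).comp h1

-- For each variance, the mean square of the product is at most `M ^ 2` times that of the second
-- factor; Parseval turns this into coefficients as the variance tends to infinity.
open MeasureTheory ProbabilityTheory in
theorem tsum_sq_mul_le {a b : ArithmeticFunction ℂ} (ha : Summable fun n => ‖a n‖)
    (hb : Summable fun n => ‖b n‖) {M : ℝ}
    (hM : ∀ ξ : ℝ, ‖LSeries (fun n => a n) (ξ * Complex.I)‖ ≤ M) :
    (Summable fun n => ‖(a * b) n‖) ∧ ∑' n, ‖(a * b) n‖ ^ 2 ≤ M ^ 2 * ∑' n, ‖b n‖ ^ 2 := by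
  have hs : ∀ ξ : ℝ, LSeriesSummable (fun n => (a * b) n) (ξ * Complex.I) := fun ξ =>
    ArithmeticFunction.LSeriesSummable_mul (LSeriesSummable_mul_I_iff.2 ha)
      (LSeriesSummable_mul_I_iff.2 hb)
  have hab : Summable fun n => ‖(a * b) n‖ := LSeriesSummable_mul_I_iff.1 (hs 0)
  refine ⟨hab, le_of_tendsto_of_tendsto' (tendsto_integral_norm_sq_LSeries hab)
    ((tendsto_integral_norm_sq_LSeries hb).const_mul (M ^ 2)) fun v => ?_⟩
  rw [← integral_const_mul]
  refine integral_mono_of_nonneg (Eventually.of_forall fun ξ => by positivity) ?_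
    (Eventually.of_forall fun ξ => ?_)
  · refine Integrable.const_mul (Integrable.of_bound (C := (∑' n, ‖b n‖) ^ 2)
      ((continuous_LSeries_mul_I hb).norm.pow 2).aestronglyMeasurable
      (Eventually.of_forall fun ξ => ?_)) _
    rw [Pi.pow_apply, norm_pow, norm_norm]
    gcongr
    exact norm_LSeries_mul_I_le hb ξ
  · simp only
    rw [ArithmeticFunction.LSeries_mul' (LSeriesSummable_mul_I_iff.2 ha)
      (LSeriesSummable_mul_I_iff.2 hb), norm_mul, mul_pow]
    gcongr
    exact hM ξ

/-! ### Gaussian damping of a bounded Dirichlet series. -/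

/-- Gaussian damping of the coefficients of a Dirichlet series. -/
noncomputable def gaussianDamp (v : NNReal) (a : ArithmeticFunction ℂ) : ArithmeticFunction ℂ :=
  ⟨fun n => a n * (Real.exp (-(v * Real.log n ^ 2 / 2)) : ℂ), by simp⟩

theorem gaussianDamp_apply (v : NNReal) (a : ArithmeticFunction ℂ) (n : ℕ) :
    gaussianDamp v a n = a n * (Real.exp (-(v * Real.log n ^ 2 / 2)) : ℂ) := rfl

theorem LSeriesSummable_gaussianDamp {v : NNReal} (hv : 0 < v) {a : ArithmeticFunction ℂ} {z : ℂ}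
    (ha : LSeriesSummable (fun n => a n) z) (s : ℂ) :
    LSeriesSummable (fun n => gaussianDamp v a n) s := by
  have hv' : (0 : ℝ) < v := hv
  -- The constant is the exponential of the maximum over `x = log n` of `x (Re z - Re s) - v x² /
  -- 2`, found by completing the square.
  refine .of_norm_bounded (ha.norm.mul_right (Real.exp ((z.re - s.re) ^ 2 / (2 * v))))
    fun n => ?_
  rcases eq_or_ne n 0 with rfl | hn
  · simp
  have hn' : (0 : ℝ) < n := by positivity
  rw [LSeries.norm_term_eq, LSeries.norm_term_eq, if_neg hn, if_neg hn, gaussianDamp_apply,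
    norm_mul, Complex.norm_real, Real.norm_of_nonneg (Real.exp_pos _).le, mul_div_assoc,
    div_eq_mul_inv ‖a n‖, mul_assoc]
  gcongr
  rw [Real.rpow_def_of_pos hn', Real.rpow_def_of_pos hn', ← Real.exp_neg, ← Real.exp_sub,
    ← Real.exp_add, Real.exp_le_exp, ← sub_nonneg]
  have : -(Real.log n * z.re) + (z.re - s.re) ^ 2 / (2 * v) -
      (-(v * Real.log n ^ 2 / 2) - Real.log n * s.re) =
      (v * Real.log n - (z.re - s.re)) ^ 2 / (2 * v) := by
    field_simp
    ring
  rw [this]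
  positivity

open MeasureTheory ProbabilityTheory in
theorem integral_LSeries_gaussianReal (v : NNReal) {a : ArithmeticFunction ℂ} {s : ℂ}
    (ha : LSeriesSummable (fun n => a n) s) :
    ∫ ξ : ℝ, LSeries (fun n => a n) (s + ξ * Complex.I) ∂gaussianReal 0 v =
      LSeries (fun n => gaussianDamp v a n) s := by
  have h := (hasSum_integral_LSeries_mul (μ := gaussianReal 0 v) (K := fun _ => 1)
    (integrable_const _) ha 1).tsum_eq
  simp only [Complex.ofReal_one, one_mul, mul_one, integral_cexp_gaussianReal] at h
  rw [← h]
  refine tsum_congr fun n => ?_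
  rcases eq_or_ne n 0 with rfl | hn
  · simp
  · rw [LSeries.term_of_ne_zero hn, LSeries.term_of_ne_zero hn, gaussianDamp_apply, neg_sq]
    ring

theorem convex_re_pos : Convex ℝ {s : ℂ | 0 < s.re} := by
  simpa using convex_halfSpace_re_gt 0

theorem isOpen_re_pos : IsOpen {s : ℂ | 0 < s.re} :=
  isOpen_lt continuous_const Complex.continuous_re

open MeasureTheory in
/-- An average of vertical translates of a bounded analytic function is analytic. -/
theorem differentiableOn_integral_vertical {μ : Measure ℝ} [IsProbabilityMeasure μ] {Φ : ℂ → ℂ}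
    {M : ℝ} (hΦ : DifferentiableOn ℂ Φ {s | 0 < s.re}) (hM : ∀ s : ℂ, 0 < s.re → ‖Φ s‖ ≤ M) :
    DifferentiableOn ℂ (fun s => ∫ ξ : ℝ, Φ (s + ξ * Complex.I) ∂μ) {s | 0 < s.re} := by
  intro s hs
  have hs : 0 < s.re := hs
  have hre : ∀ (z : ℂ) (ξ : ℝ), (z + ξ * Complex.I).re = z.re := by simp
  have hball : ∀ z w : ℂ, z ∈ Metric.closedBall w (s.re / 4) → w.re - s.re / 4 ≤ z.re := by
    intro z w hz
    have h1 := (Complex.abs_re_le_norm (z - w)).trans (mem_closedBall_iff_norm.1 hz)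
    rw [Complex.sub_re] at h1
    linarith [(abs_le.1 h1).1]
  have hvert : ∀ z : ℂ, 0 < z.re → ∀ {Ψ : ℂ → ℂ}, ContinuousOn Ψ {s | 0 < s.re} →
      Continuous fun ξ : ℝ => Ψ (z + ξ * Complex.I) := by
    intro z hz Ψ hΨ
    exact hΨ.comp_continuous (by fun_prop) fun ξ => by
      simpa only [Set.mem_ofPred_eq, hre] using hz
  -- Differentiation under the integral; the dominating constant is Cauchy's estimate on discs of
  -- radius `Re s / 4`, which stay inside the half-plane.
  refine DifferentiableAt.differentiableWithinAt (HasDerivAt.differentiableAt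
    (hasDerivAt_integral_of_dominated_loc_of_deriv_le (s := Metric.ball s (s.re / 4))
    (F := fun z (ξ : ℝ) => Φ (z + ξ * Complex.I))
    (F' := fun z (ξ : ℝ) => deriv Φ (z + ξ * Complex.I)) (bound := fun _ => M / (s.re / 4))
    (Metric.ball_mem_nhds _ (by linarith)) ?_ ?_ ?_ ?_ (integrable_const _) ?_).2)
  · filter_upwards [isOpen_re_pos.mem_nhds hs] with z hz
    exact (hvert z hz hΦ.continuousOn).aestronglyMeasurable
  · exact Integrable.of_bound (hvert s hs hΦ.continuousOn).aestronglyMeasurable M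
      (Eventually.of_forall fun ξ => hM _ (by rwa [hre]))
  · exact (hvert s hs (hΦ.deriv isOpen_re_pos).continuousOn).aestronglyMeasurable
  · refine Eventually.of_forall fun ξ z hz => ?_
    have hz' := hball z s (Metric.ball_subset_closedBall hz)
    have hsub : Metric.closedBall (z + ξ * Complex.I) (s.re / 4) ⊆ {s : ℂ | 0 < s.re} := by
      intro w hw
      have := hball w _ hw
      rw [hre] at this
      simp only [Set.mem_ofPred_eq]
      linarith
    refine Complex.norm_deriv_le_of_forall_mem_sphere_norm_le (by linarith)
      (hΦ.mono (Metric.closure_ball_subset_closedBall.trans hsub)).diffContOnCl fun w hw =>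
        hM w (hsub (Metric.sphere_subset_closedBall hw))
  · refine Eventually.of_forall fun ξ z hz => ?_
    have hz' := hball z s (Metric.ball_subset_closedBall hz)
    have : DifferentiableAt ℂ Φ (z + ξ * Complex.I) :=
      hΦ.differentiableAt (isOpen_re_pos.mem_nhds (by
        simp only [Set.mem_ofPred_eq, hre]
        linarith))
    simpa using this.hasDerivAt.comp_add_const z (ξ * Complex.I)

/-- Convergence at the real point `Re s / 2` bounds the partial sums there, and the Abel-summed
series is analytic to its right. -/
theorem differentiableOn_of_hasDirichletSeries {F : halfPlane 0 → ℂ} {a : ArithmeticFunction ℂ}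
    (hF : HasDirichletSeries F a) {Φ : ℂ → ℂ} (hΦ : ∀ s : halfPlane 0, Φ s = F s) :
    DifferentiableOn ℂ Φ {s | 0 < s.re} := by
  intro s hs
  have hs : 0 < s.re := hs
  set σ : ℂ := ((s.re / 2 : ℝ) : ℂ) with hσ
  have hσre : σ.re = s.re / 2 := Complex.ofReal_re _
  obtain ⟨C, hC⟩ := (hF ⟨σ, by simpa [halfPlane, hσre] using hs⟩).norm.bddAbove_range
  have hC' : ∀ n, ‖partialSum a σ n‖ ≤ C := fun n => hC ⟨n, rfl⟩
  have hU : IsOpen {z : ℂ | 0 < (z - σ).re} :=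
    isOpen_lt continuous_const (Complex.continuous_re.comp (continuous_id.sub continuous_const))
  have hsU : s ∈ {z : ℂ | 0 < (z - σ).re} := by
    simp only [Set.mem_ofPred_eq, Complex.sub_re, hσre]
    linarith
  have h1 : DifferentiableOn ℂ
      (fun z => ∑' n, partialSum a σ n * abelWeight (z - σ) n) {z : ℂ | 0 < (z - σ).re} :=
    (differentiableOn_tsum_abelWeight hC').comp (g := fun w => ∑' n, partialSum a σ n *
      abelWeight w n) (differentiableOn_id.sub (differentiableOn_const σ)) fun z hz => hz
  have h2 : Set.EqOn Φ (fun z => ∑' n, partialSum a σ n * abelWeight (z - σ) n)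
      {z : ℂ | 0 < (z - σ).re} := by
    intro z hz
    have hz : 0 < (z - σ).re := hz
    have hz0 : 0 < z.re := by
      rw [Complex.sub_re, hσre] at hz
      linarith
    have h3 := tendsto_partialSum_add (C := C) le_rfl hz (by simpa using hC')
    rw [add_sub_cancel] at h3
    exact (hΦ ⟨z, hz0⟩).trans (tendsto_nhds_unique (hF ⟨z, hz0⟩) h3)
  exact ((h1.congr h2).differentiableAt (hU.mem_nhds hsU)).differentiableWithinAt

open MeasureTheory ProbabilityTheory in
/-- Gaussian damping does not increase the supremum of a Dirichlet series over `Re s > 0`. -/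
theorem norm_LSeries_gaussianDamp_le {F : halfPlane 0 → ℂ} {a : ArithmeticFunction ℂ}
    (hF : HasDirichletSeries F a) {M : ℝ} (hM : ∀ s, ‖F s‖ ≤ M) {v : NNReal} (hv : 0 < v) :
    (Summable fun n => ‖gaussianDamp v a n‖) ∧
      ∀ ξ : ℝ, ‖LSeries (fun n => gaussianDamp v a n) (ξ * Complex.I)‖ ≤ M := by
  classical
  let Φ : ℂ → ℂ := fun s => if h : 0 < s.re then F ⟨s, h⟩ else 0
  have hΦ : ∀ s : halfPlane 0, Φ s = F s := fun s => dif_pos s.2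
  have hΦd := differentiableOn_of_hasDirichletSeries hF hΦ
  have hΦM : ∀ s : ℂ, 0 < s.re → ‖Φ s‖ ≤ M := fun s hs => by
    rw [hΦ ⟨s, hs⟩]
    exact hM _
  obtain ⟨y, hy, -⟩ := EReal.exists_between_coe_real (abscissa_lt_top hF)
  have hsum : ∀ s : ℂ, y < s.re → LSeriesSummable (fun n => a n) s := fun s hs =>
    LSeriesSummable_of_abscissaOfAbsConv_lt_re (hy.trans (by exact_mod_cast hs))
  have hdamp : ∀ s, LSeriesSummable (fun n => gaussianDamp v a n) s :=
    LSeriesSummable_gaussianDamp hv (hsum ((y + 1 : ℝ) : ℂ) (by simp))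
  have hbot : LSeries.abscissaOfAbsConv (fun n => gaussianDamp v a n) = ⊥ :=
    le_bot_iff.1 (LSeries.abscissaOfAbsConv_le_of_forall_lt_LSeriesSummable' fun y _ => hdamp y)
  have hent : Differentiable ℂ (LSeries fun n => gaussianDamp v a n) := by
    have := LSeries_differentiableOn (fun n => gaussianDamp v a n)
    rw [hbot] at this
    exact differentiableOn_univ.1 (this.mono fun z _ => EReal.bot_lt_coe _)
  -- Far to the right the undamped series converges absolutely and may be averaged termwise; the
  -- identity theorem carries the equality to the whole half-plane.
  have heq : Set.EqOn (LSeries fun n => gaussianDamp v a n)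
      (fun s => ∫ ξ : ℝ, Φ (s + ξ * Complex.I) ∂gaussianReal 0 v) {s | 0 < s.re} := by
    set z₀ : ℂ := ((max y 0 + 1 : ℝ) : ℂ) with hz₀
    have hz₀re : z₀.re = max y 0 + 1 := Complex.ofReal_re _
    refine (hent.differentiableOn.analyticOnNhd isOpen_re_pos).eqOn_of_preconnected_of_eventuallyEq
      ((differentiableOn_integral_vertical hΦd hΦM).analyticOnNhd isOpen_re_pos)
      convex_re_pos.isPreconnected (z₀ := z₀) (by
        simp only [Set.mem_ofPred_eq, hz₀re]
        positivity) ?_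
    have hopen : IsOpen {s : ℂ | max y 0 < s.re} :=
      isOpen_lt continuous_const Complex.continuous_re
    filter_upwards [hopen.mem_nhds (show max y 0 < z₀.re by linarith)] with s hs
    obtain ⟨h1, h2⟩ := max_lt_iff.1 (show max y 0 < s.re from hs)
    rw [← integral_LSeries_gaussianReal v (hsum s h1)]
    refine integral_congr_ae (Eventually.of_forall fun ξ => ?_)
    have h3 : (s + ξ * Complex.I).re = s.re := by simp
    simp only
    have h4 : s + ξ * Complex.I ∈ halfPlane 0 := h2.trans_eq h3.symm
    rw [hΦ ⟨_, h4⟩]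
    exact eq_LSeries hF ⟨_, h4⟩ (hsum _ (h1.trans_eq h3.symm))
  have hpos : ∀ s : ℂ, 0 < s.re → ‖LSeries (fun n => gaussianDamp v a n) s‖ ≤ M := by
    intro s hs
    rw [heq hs]
    refine (norm_integral_le_of_norm_le_const (C := M) (Eventually.of_forall fun ξ =>
      hΦM _ (by simpa using hs))).trans ?_
    simp
  refine ⟨LSeriesSummable_mul_I_iff.1 (hdamp ((0 : ℝ) * Complex.I)), fun ξ => ?_⟩
  have hcont : Continuous fun ε : ℝ =>
      ‖LSeries (fun n => gaussianDamp v a n) (ξ * Complex.I + ε)‖ :=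
    (hent.continuous.comp (by fun_prop)).norm
  have hlim := (hcont.tendsto 0).mono_left (nhdsWithin_le_nhds (s := Set.Ioi 0))
  simp only [Complex.ofReal_zero, add_zero] at hlim
  refine le_of_tendsto hlim ?_
  filter_upwards [self_mem_nhdsWithin] with ε hε
  exact hpos _ (by simpa using hε)

/-! ### Bounded Dirichlet series as multipliers, and the norm. -/

/-- The initial segment of an arithmetic function, up to `N` excluded. -/
noncomputable def initialPart (N : ℕ) (b : ArithmeticFunction ℂ) : ArithmeticFunction ℂ :=
  ⟨fun n => if n < N then b n else 0, by simp⟩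

theorem initialPart_apply (N : ℕ) (b : ArithmeticFunction ℂ) (n : ℕ) :
    initialPart N b n = if n < N then b n else 0 := rfl

theorem mul_initialPart_of_lt (a b : ArithmeticFunction ℂ) {n N : ℕ} (hn : n < N) :
    (a * initialPart N b) n = (a * b) n := by
  rw [ArithmeticFunction.mul_apply, ArithmeticFunction.mul_apply]
  refine Finset.sum_congr rfl fun p hp => ?_
  rw [initialPart_apply, if_pos]
  exact (Nat.divisor_le (Nat.snd_mem_divisors_of_mem_antidiagonal hp)).trans_lt hn

theorem tendsto_gaussianDamp_mul (a b : ArithmeticFunction ℂ) (n : ℕ) :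
    Tendsto (fun v : NNReal => (gaussianDamp v a * b) n) (𝓝[>] 0) (𝓝 ((a * b) n)) := by
  have : Continuous fun v : NNReal => (gaussianDamp v a * b) n := by
    simp only [ArithmeticFunction.mul_apply, gaussianDamp_apply]
    fun_prop
  have h := (this.tendsto 0).mono_left (nhdsWithin_le_nhds (s := Set.Ioi 0))
  have h0 : gaussianDamp 0 a = a := by
    ext n
    simp [gaussianDamp_apply]
  rwa [h0] at h

/-- Coefficients of `a * b` below `N` see only those of `b` below `N`, so `b` may be truncated and
`a` damped; with finitely many coefficients the damping can be removed in the limit. -/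
theorem sum_sq_mul_le {F : halfPlane 0 → ℂ} {a : ArithmeticFunction ℂ}
    (hF : HasDirichletSeries F a) {M : ℝ} (hM : ∀ s, ‖F s‖ ≤ M) {b : ArithmeticFunction ℂ}
    (hb : Summable fun n => ‖b n‖ ^ 2) (N : ℕ) :
    ∑ n ∈ Finset.range N, ‖(a * b) n‖ ^ 2 ≤ M ^ 2 * ∑' n, ‖b n‖ ^ 2 := by
  have hzero : ∀ n ∉ Finset.range N, initialPart N b n = 0 := fun n hn => by
    rw [initialPart_apply, if_neg (by simpa using hn)]
  have hbN : Summable fun n => ‖initialPart N b n‖ :=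
    summable_of_ne_finset_zero (s := Finset.range N) fun n hn => by simp [hzero n hn]
  have hbN2 : ∑' n, ‖initialPart N b n‖ ^ 2 ≤ ∑' n, ‖b n‖ ^ 2 := by
    rw [tsum_eq_sum (s := Finset.range N) fun n hn => by simp [hzero n hn]]
    refine (Finset.sum_le_sum fun n hn => ?_).trans (hb.sum_le_tsum _ fun n _ => by positivity)
    rw [initialPart_apply, if_pos (Finset.mem_range.1 hn)]
  refine le_of_tendsto (tendsto_finsetSum _ fun n _ =>
    (tendsto_gaussianDamp_mul a b n).norm.pow 2) ?_
  filter_upwards [self_mem_nhdsWithin] with v hv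
  obtain ⟨h1, h2⟩ := norm_LSeries_gaussianDamp_le hF hM (show 0 < v from hv)
  obtain ⟨h3, h4⟩ := tsum_sq_mul_le h1 hbN h2
  have h5 : Summable fun n => ‖(gaussianDamp v a * initialPart N b) n‖ ^ 2 := by
    simpa only [sq, Function.comp_def] using (h3.mul_of_nonneg h3 (fun _ => norm_nonneg _)
      fun _ => norm_nonneg _).comp_injective (i := fun n => (n, n)) fun m n h => congrArg Prod.fst h
  calc ∑ n ∈ Finset.range N, ‖(gaussianDamp v a * b) n‖ ^ 2
      = ∑ n ∈ Finset.range N, ‖(gaussianDamp v a * initialPart N b) n‖ ^ 2 :=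
        Finset.sum_congr rfl fun n hn => by
          rw [mul_initialPart_of_lt _ _ (Finset.mem_range.1 hn)]
    _ ≤ ∑' n, ‖(gaussianDamp v a * initialPart N b) n‖ ^ 2 :=
        h5.sum_le_tsum _ fun n _ => by positivity
    _ ≤ M ^ 2 * ∑' n, ‖initialPart N b n‖ ^ 2 := h4
    _ ≤ _ := by gcongr

theorem convolutionBound_of_hasDirichletSeries {F : halfPlane 0 → ℂ} {a : ArithmeticFunction ℂ}
    (hF : HasDirichletSeries F a) {M : ℝ} (hM : ∀ s, ‖F s‖ ≤ M) (S : Set ℕ+) :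
    ConvolutionBound S a M := by
  have hM0 : 0 ≤ M := (norm_nonneg _).trans (hM ⟨1, by simp [halfPlane]⟩)
  intro b _ hb
  have h := sum_sq_mul_le hF hM hb
  refine ⟨summable_of_sum_range_le (fun n => by positivity) h, ?_⟩
  rw [Real.sqrt_le_left (by positivity), mul_pow, Real.sq_sqrt (tsum_nonneg fun n => by positivity)]
  exact Real.tsum_le_of_sum_range_le (fun n => by positivity) h

theorem Extends.hasDirichletSeries {F : halfPlane 0 → ℂ} {f : halfPlane (1 / 2) → ℂ}
    (h : Extends F f) {a : ArithmeticFunction ℂ} (hF : HasDirichletSeries F a) :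
    HasDirichletSeries f a := by
  intro s
  have hs : 1 / 2 < (s : ℂ).re := s.2
  have h0 : (s : ℂ) ∈ halfPlane 0 := show 0 < (s : ℂ).re by linarith
  rw [← h s h0 s.2]
  exact hF ⟨s, h0⟩

/-- The product of the restriction of a bounded Dirichlet series with an element of `𝓗²`. -/
theorem hasDirichletSeries_mul_of_convolutionBound {S : Set ℕ+} (hS : 1 ∈ S)
    {f g : halfPlane (1 / 2) → ℂ} {a b : ArithmeticFunction ℂ} {M : ℝ}
    (h : ConvolutionBound S a M) (hf : HasDirichletSeries f a) (hg : HasDirichletSeries g b)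
    (hb : Summable fun n => ‖b n‖ ^ 2) : HasDirichletSeries (f * g) (a * b) := by
  have ha := (h 1 (supportedOn_one hS) hasSum_sq_one.summable).1
  rw [mul_one] at ha
  exact hf.mul hg (fun s => LSeriesSummable_of_summable_sq ha s.2)
    fun s => LSeriesSummable_of_summable_sq hb s.2

/-- Homogeneity: rescale `b` by its norm, the case of norm zero being trivial. -/
theorem convolutionBound_of_unit_ball {S : Set ℕ+} {a : ArithmeticFunction ℂ} {M : ℝ}
    (hsum : ∀ b : ArithmeticFunction ℂ, SupportedOn S b → (Summable fun n => ‖b n‖ ^ 2) →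
      Summable fun n => ‖(a * b) n‖ ^ 2)
    (h : ∀ b : ArithmeticFunction ℂ, SupportedOn S b → (Summable fun n => ‖b n‖ ^ 2) →
      √(∑' n, ‖b n‖ ^ 2) ≤ 1 → √(∑' n, ‖(a * b) n‖ ^ 2) ≤ M) :
    ConvolutionBound S a M := by
  intro b hb hb2
  refine ⟨hsum b hb hb2, ?_⟩
  set β := √(∑' n, ‖b n‖ ^ 2) with hβ
  rcases (Real.sqrt_nonneg _ : 0 ≤ β).eq_or_lt with h0 | h0
  · have h1 : ∑' n, ‖b n‖ ^ 2 = 0 :=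
      (Real.sqrt_eq_zero (tsum_nonneg fun n => by positivity)).1 (hβ ▸ h0.symm)
    have h2 := (hasSum_zero_iff_of_nonneg fun n => by positivity).1 (h1 ▸ hb2.hasSum)
    have h3 : b = 0 := by
      ext n
      simpa using congrFun h2 n
    simp [h3, show β = 0 from h0.symm]
  let b' : ArithmeticFunction ℂ := ⟨fun n => (β⁻¹ : ℂ) * b n, by simp⟩
  have hb' : ∀ n, b' n = (β⁻¹ : ℂ) * b n := fun n => rfl
  have hab' : ∀ n, (a * b') n = (β⁻¹ : ℂ) * (a * b) n := fun n => by
    simp only [ArithmeticFunction.mul_apply, hb', Finset.mul_sum]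
    exact Finset.sum_congr rfl fun p _ => by ring
  have hnorm : ∀ z : ℂ, ‖(β⁻¹ : ℂ) * z‖ ^ 2 = (β⁻¹) ^ 2 * ‖z‖ ^ 2 := fun z => by
    rw [norm_mul, mul_pow, norm_inv, Complex.norm_real, Real.norm_of_nonneg h0.le]
  have key := h b' (fun n hn => by rw [hb', hb n hn, mul_zero])
    (by simpa only [hb', hnorm] using hb2.mul_left _) ?_
  · simp only [hab', hnorm, tsum_mul_left] at key
    rw [Real.sqrt_mul (by positivity), Real.sqrt_sq (by positivity),
      inv_mul_le_iff₀ h0] at key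
    linarith
  · simp only [hb', hnorm, tsum_mul_left]
    rw [Real.sqrt_mul (by positivity), Real.sqrt_sq (by positivity), ← hβ, inv_mul_cancel₀ h0.ne']

end DirichletHardy

theorem mainTheorem1 (S : Subsemigroup ℕ+) (hS : 1 ∈ S)
    (f : DirichletHardy.halfPlane (1 / 2) → ℂ) :
    ((∀ g ∈ DirichletHardy.H2 (S : Set ℕ+), f * g ∈ DirichletHardy.H2 (S : Set ℕ+)) ↔
      ∃ F ∈ DirichletHardy.HInfty (S : Set ℕ+), DirichletHardy.Extends F f) ∧
    (∀ F ∈ DirichletHardy.HInfty (S : Set ℕ+), DirichletHardy.Extends F f →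
      IsLUB {r : ℝ | ∃ g ∈ DirichletHardy.H2 (S : Set ℕ+),
          DirichletHardy.norm2 g ≤ 1 ∧ r = DirichletHardy.norm2 (f * g)}
        (DirichletHardy.supNorm F)) := by
  open DirichletHardy in
  have hS' : 1 ∈ (S : Set ℕ+) := hS
  refine ⟨⟨exists_extension_of_multiplier hS, ?_⟩, ?_⟩
  · rintro ⟨F, ⟨a, ha, hF, M, hM⟩, hFf⟩ g ⟨b, hb, hb2, hgb⟩
    have hbd := convolutionBound_of_hasDirichletSeries hF (fun s => hM ⟨s, rfl⟩) (S : Set ℕ+)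
    exact ⟨a * b, ha.mul hb, (hbd b hb hb2).1, hasDirichletSeries_mul_of_convolutionBound hS' hbd
      (hFf.hasDirichletSeries hF) hgb hb2⟩
  · rintro F ⟨a, ha, hF, hbdd⟩ hFf
    have hf := hFf.hasDirichletSeries hF
    have hbd := convolutionBound_of_hasDirichletSeries hF (fun s => le_ciSup hbdd s) (S : Set ℕ+)
    have hmul : ∀ {g b}, HasDirichletSeries g b → (Summable fun n => ‖b n‖ ^ 2) →
        norm2 (f * g) = √(∑' n, ‖(a * b) n‖ ^ 2) := fun hgb hb2 =>
      norm2_eq (hasDirichletSeries_mul_of_convolutionBound hS' hbd hf hgb hb2)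
    have hF0 : 0 ≤ ⨆ s, ‖F s‖ := Real.iSup_nonneg fun s => norm_nonneg _
    refine ⟨?_, fun M hM => ?_⟩
    · rintro _ ⟨g, ⟨b, hb, hb2, hgb⟩, hg1, rfl⟩
      rw [norm2_eq hgb] at hg1
      rw [hmul hgb hb2]
      exact (hbd b hb hb2).2.trans (mul_le_of_le_one_right hF0 hg1)
    -- Any upper bound `M` of the norms on the unit ball is a convolution bound, hence bounds the
    -- sum of the series on `Re s > 0`, which is `F`.
    · have hMb : ConvolutionBound (S : Set ℕ+) a M :=
        convolutionBound_of_unit_ball (fun b hb hb2 => (hbd b hb hb2).1) fun b hb hb2 hb1 => by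
          obtain ⟨hg, hgb⟩ := LSeries_mem_H2 hb hb2
          rw [← hmul hgb hb2]
          exact hM ⟨_, hg, (norm2_eq hgb).trans_le hb1, rfl⟩
      have hM0 : 0 ≤ M := by
        have := (hMb 1 (supportedOn_one hS') hasSum_sq_one.summable).2
        rw [hasSum_sq_one.tsum_eq, Real.sqrt_one, mul_one, mul_one] at this
        exact (Real.sqrt_nonneg _).trans this
      obtain ⟨G, hG, hGM⟩ := hMb.exists_hasDirichletSeries hS ha hM0
      have : Nonempty (halfPlane 0) := ⟨⟨1, by simp [halfPlane]⟩⟩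
      exact ciSup_le fun s => tendsto_nhds_unique (hG s) (hF s) ▸ hGM s
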